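/- Let $X$ be a CAT(0) cube complex of finite dimension $D$, that is, a simply connected cubical complex (cubes are embedded and two cubes that meet do so in a common face) in which the link of every vertex is a flag complex. Fix a base vertex $x_0$. Let $d$ be the edge-path metric on vertices and $H$ the set of hyperplanes of $X$ (classes of edges under the equivalence relation generated by being opposite in a square). For $h\in H$ let $h^-$ be the halfspace (side of $h$, as a set of vertices) containing $x_0$ and $h^+$ the other one. Write $k<h$ if $h^+\subsetneq k^+$ (then $h$ is said to lie in $k^+$); $k$ is a *predecessor* of $h$ if $k<h$ and there is no $j$ with $k<j<h$. Hyperplanes $h,k$ *cross* if all four intersections $h^\pm\cap k^\pm$ are non-empty. For $d\ge 2$, a *$d$-corner* is an intersection $k_1^+\cap\dots\cap k_d^+$ with $k_1,\dots,k_d$ pairwise crossing distinct hyperplanes (its bounding hyperplanes); $h$ lies in it if $k_i<h$ for all $i$. *Flatness.* $X$ is $d$-flat if no hyperplane lies in a $d$-corner. The flatness $f$ of $X$ is the least $d\ge 1$ such that $X$ is $(d+1)$-flat. *Ranks.* For $S\subseteq H$ and $d\ge2$ put $S^d_{\ge 0}=S$, and let $S^d_{\ge n+1}$ be the set of $h\in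 S^d_{\ge n}$ that lie in some $d$-corner bounded by hyperplanes in $S^d_{\ge n}$. The $d$-rank in $S$ of $h\in S$ is the $n$ with $h\in S^d_{\ge n}\setminus S^d_{\ge n+1}$. Let $H_{(n_D)}$ be the set of hyperplanes with $D$-rank $n_D$ in $H$, and inductively let $H_{(n_D,\dots,n_{d})}$ be the set of $h\in H_{(n_D,\dots,n_{d+1})}$ with $d$-rank $n_d$ in $H_{(n_D,\dots,n_{d+1})}$, for $d=D-1,\dots,2$. The *rank-vector* of $h$ is the vector $\mathbf r(h)=(n_D,\dots,n_2)$ with $h\in H_{(n_D,\dots,n_2)}$; rank-vectors are ordered lexicographically. *Colouring.* A predecessor $k$ of $h$ is *$\mathbf r$-maximal* if $\mathbf r(j)\le\mathbf r(k)$ for all predecessors $j$ of $h$. Consider the recursion for $c\colon H\to\{0,1\}$: $c(h)=1$ if all $\mathbf r$-maximal predecessors of $h$ have colour $0$, and $c(h)=0$ otherwise. **Theorem.** There is exactly one map $c\colon H\to\{0,1\}$ satisfying this recursion, and it is a $3^{f-1}D$-controlled colouring of $H$: if $s$ is an edge geodesic of $X$ such that each of its edges, from $x$ to $y$ say, satisfies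 $d(x_0,y)<d(x_0,x)$ (an inward geodesic), and all hyperplanes crossed by $s$ have the same colour, then the length of $s$ is at most $3^{f-1}D$. -/

import Mathlib

universe u

/-- `φ` identifies the vertex set of the combinatorial `n`-cube `{0,1}ⁿ` with a subset of `V`, in
such a way that the members of `K` contained in the image are exactly the images of the faces of
`{0,1}ⁿ`. A face is given by prescribing some of the coordinates (`σ i = some b`) and leaving the
others free (`σ i = none`). -/
def IsCubeChart {V : Type u} (K : Set (Set V)) (n : ℕ) (φ : (Fin n → Bool) → V) : Prop :=
  Function.Injective φ ∧
    ∀ s : Set V, s ⊆ Set.range φ →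
      (s ∈ K ↔ ∃ σ : Fin n → Option Bool, s = φ '' {x | ∀ i b, σ i = some b → x i = b})

/-- A cubical complex with vertex set `V`, given by the vertex sets of its cubes: finite dimensional
cubes are embedded, faces of cubes are cubes, and two cubes that meet do so in a common face.
(A nonempty intersection of two cubes is again a cube, and so by `chart` a face of both.) -/
structure CubeComplex (V : Type u) where
  /-- the vertex sets of the cubes -/
  cubes : Set (Set V)
  singleton_mem : ∀ v, {v} ∈ cubes
  inter_mem : ∀ c ∈ cubes, ∀ c' ∈ cubes, (c ∩ c').Nonempty → c ∩ c' ∈ cubes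
  chart : ∀ c ∈ cubes, ∃ (n : ℕ) (φ : (Fin n → Bool) → V), IsCubeChart cubes n φ ∧ Set.range φ = c

namespace CubeComplex

variable {V : Type u}

/-- `c` is (the vertex set of) an `n`-dimensional cube of `X`. -/
def IsCube (X : CubeComplex V) (n : ℕ) (c : Set V) : Prop :=
  c ∈ X.cubes ∧ ∃ φ : (Fin n → Bool) → V, IsCubeChart X.cubes n φ ∧ Set.range φ = c

/-- `X` has dimension `D`: the largest dimension of a cube of `X` is `D`. -/
def HasDimension (X : CubeComplex V) (D : ℕ) : Prop :=
  IsGreatest {n : ℕ | ∃ c, X.IsCube n c} D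

/-- The 1-skeleton of `X`. Its graph distance `X.graph.dist` is the edge-path metric. -/
def graph (X : CubeComplex V) : SimpleGraph V where
  Adj v w := v ≠ w ∧ {v, w} ∈ X.cubes
  symm := ⟨fun v w h => ⟨h.1.symm, by rw [Set.pair_comm]; exact h.2⟩⟩
  loopless := ⟨fun _ h => h.1 rfl⟩

/-- `a, b, c, d` are the vertices of a square of `X`, in cyclic order. -/
structure IsSquare (X : CubeComplex V) (a b c d : V) : Prop where
  ab : X.graph.Adj a b
  bc : X.graph.Adj b c
  cd : X.graph.Adj c d
  da : X.graph.Adj d a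
  ac : a ≠ c
  bd : b ≠ d
  mem : {a, b, c, d} ∈ X.cubes

/-! ### The CAT(0) condition -/

/-- Homotopy of edge paths with fixed endpoints in `X`: the congruence generated by removing
backtracks and by pushing a path across a square. -/
inductive Homotopic (X : CubeComplex V) :
    ∀ {u v : V}, X.graph.Walk u v → X.graph.Walk u v → Prop
  | refl {u v : V} (p : X.graph.Walk u v) : Homotopic X p p
  | symm {u v : V} {p q : X.graph.Walk u v} : Homotopic X p q → Homotopic X q p
  | trans {u v : V} {p q r : X.graph.Walk u v} :
      Homotopic X p q → Homotopic X q r → Homotopic X p r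
  | cons {u v w : V} (h : X.graph.Adj u v) {p q : X.graph.Walk v w} :
      Homotopic X p q → Homotopic X (.cons h p) (.cons h q)
  | backtrack {u v w : V} (h : X.graph.Adj u v) (p : X.graph.Walk u w) :
      Homotopic X (.cons h (.cons h.symm p)) p
  | square {a b c d w : V} (h : X.IsSquare a b c d) (p : X.graph.Walk c w) :
      Homotopic X (.cons h.ab (.cons h.bc p)) (.cons h.da.symm (.cons h.cd.symm p))

/-- `X` is simply connected: it is connected and every closed edge path is null-homotopic
(i.e. the edge-path group of the 2-skeleton is trivial). -/
def SimplyConnected (X : CubeComplex V) : Prop :=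
  X.graph.Connected ∧ ∀ (v : V) (p : X.graph.Walk v v), X.Homotopic p .nil

/-- The finite set `S` of neighbours of `v` (a set of vertices of the link of `v`)
spans a simplex of the link of `v`: the edges from `v` to `S` lie in a common cube. -/
def IsLinkSimplex (X : CubeComplex V) (v : V) (S : Finset V) : Prop :=
  (∀ w ∈ S, X.graph.Adj v w) ∧ ∃ c ∈ X.cubes, v ∈ c ∧ (S : Set V) ⊆ c

open Classical in
/-- The link of `v` is a flag complex: finitely many vertices of the link that are pairwise joined
by edges of the link span a simplex. -/
def IsFlagLink (X : CubeComplex V) (v : V) : Prop :=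
  ∀ S : Finset V, (∀ a ∈ S, ∀ b ∈ S, X.IsLinkSimplex v {a, b}) → X.IsLinkSimplex v S

/-- A CAT(0) cube complex: simply connected, with flag vertex links. -/
def IsCAT0 (X : CubeComplex V) : Prop :=
  X.SimplyConnected ∧ ∀ v, X.IsFlagLink v

/-! ### Hyperplanes -/

/-- Two edges are opposite edges of a square. -/
def Opposite (X : CubeComplex V) (e e' : X.graph.edgeSet) : Prop :=
  ∃ a b c d, X.IsSquare a b c d ∧ e.1 = s(a, b) ∧ e'.1 = s(d, c)

/-- The hyperplanes of `X`: the classes of edges for the equivalence relation generated by being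
opposite edges of a square. -/
def Hyperplane (X : CubeComplex V) : Type u := Quot X.Opposite

/-- The set of edges of `X` that cross the hyperplane `h`. -/
def edgesOf (X : CubeComplex V) (h : X.Hyperplane) : Set (Sym2 V) :=
  {e | ∃ he : e ∈ X.graph.edgeSet, Quot.mk X.Opposite ⟨e, he⟩ = h}

/-- The inward halfspace `h⁻`: the vertices that can be joined to the basepoint by an edge path
that does not cross `h`. -/
def inward (X : CubeComplex V) (x₀ : V) (h : X.Hyperplane) : Set V :=
  {x | (X.graph.deleteEdges (X.edgesOf h)).Reachable x₀ x}

/-- The outward halfspace `h⁺`: the side of `h` that does not contain the basepoint. -/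
def outward (X : CubeComplex V) (x₀ : V) (h : X.Hyperplane) : Set V :=
  (X.inward x₀ h)ᶜ

/-- `k < h`: the hyperplane `k` separates `x₀` from `h`, i.e. `k⁺` strictly contains `h⁺`. -/
def Below (X : CubeComplex V) (x₀ : V) (k h : X.Hyperplane) : Prop :=
  X.outward x₀ h ⊂ X.outward x₀ k

/-- `k` is a predecessor of `h`: `k < h` with no hyperplane strictly between them. -/
def IsPredecessor (X : CubeComplex V) (x₀ : V) (k h : X.Hyperplane) : Prop :=
  X.Below x₀ k h ∧ ¬ ∃ j, X.Below x₀ k j ∧ X.Below x₀ j h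

/-- `h` and `k` cross (intersect): all four quadrants are nonempty. -/
def Cross (X : CubeComplex V) (x₀ : V) (h k : X.Hyperplane) : Prop :=
  (X.inward x₀ h ∩ X.inward x₀ k).Nonempty ∧ (X.inward x₀ h ∩ X.outward x₀ k).Nonempty ∧
    (X.outward x₀ h ∩ X.inward x₀ k).Nonempty ∧ (X.outward x₀ h ∩ X.outward x₀ k).Nonempty

/-! ### Ranks, flatness and rank-vectors -/

/-- `h` is contained in some (outward) `d`-corner `⋂ k ∈ T, k⁺` bounded by hyperplanes in `S`, where
`T` consists of `d` pairwise crossing hyperplanes. That `h` is contained in `k⁺` means `k < h`. -/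
def InCorner (X : CubeComplex V) (x₀ : V) (d : ℕ) (S : Set X.Hyperplane) (h : X.Hyperplane) :
    Prop :=
  ∃ T : Finset X.Hyperplane, T.card = d ∧ (T : Set X.Hyperplane) ⊆ S ∧
    (T : Set X.Hyperplane).Pairwise (X.Cross x₀) ∧ ∀ k ∈ T, X.Below x₀ k h

/-- The set `Hᵈ_{≥ n}`, computed in the set `S` of hyperplanes. For `S = Set.univ` this is the set
for `X` itself, and in general it is the set for the quotient complex of `X` with set of
hyperplanes `S`, in which order and crossing of hyperplanes are those of `X`. -/
def rankGE (X : CubeComplex V) (x₀ : V) (d : ℕ) (S : Set X.Hyperplane) : ℕ → Set X.Hyperplane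
  | 0 => S
  | n + 1 => {h | h ∈ rankGE X x₀ d S n ∧ X.InCorner x₀ d (rankGE X x₀ d S n) h}

/-- The `d`-rank of `h ∈ S` in the set `S` of hyperplanes: the `n` with
`h ∈ Hᵈ_{≥ n} \ Hᵈ_{≥ n + 1}`. -/
noncomputable def rank (X : CubeComplex V) (x₀ : V) (d : ℕ) (S : Set X.Hyperplane)
    (h : X.Hyperplane) : ℕ :=
  sInf {n | h ∈ X.rankGE x₀ d S n ∧ h ∉ X.rankGE x₀ d S (n + 1)}

/-- `X` is `d`-flat (`d ≥ 2`): no hyperplane lies in a `d`-corner. -/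
def IsFlat (X : CubeComplex V) (x₀ : V) (d : ℕ) : Prop :=
  ∀ h : X.Hyperplane, ¬ X.InCorner x₀ d Set.univ h

/-- The flatness of `X`: the least `d` such that `X` is `(d + 1)`-flat; as corners are `d`-corners
with `d ≥ 2`, here `d ≥ 1`. -/
noncomputable def flatness (X : CubeComplex V) (x₀ : V) : ℕ :=
  sInf {d | 1 ≤ d ∧ X.IsFlat x₀ (d + 1)}

/-- The piece `H_{(n_D, …, n_{D-i+1})}` of the `i`-th subdivision of the set of hyperplanes that
contains `h`: the piece `H_{(n_D, …, n_{D-i+1})}` is subdivided by the `(D-i)`-rank in it. -/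
noncomputable def rankClass (X : CubeComplex V) (x₀ : V) (D : ℕ) (h : X.Hyperplane) :
    ℕ → Set X.Hyperplane
  | 0 => Set.univ
  | i + 1 => {k | k ∈ rankClass X x₀ D h i ∧
      X.rank x₀ (D - i) (rankClass X x₀ D h i) k = X.rank x₀ (D - i) (rankClass X x₀ D h i) h}

/-- The rank-vector `(n_D, …, n_2)` of `h`, in the lexicographic order; the entry of index `i`
is `n_{D-i}`. -/
noncomputable def rankVector (X : CubeComplex V) (x₀ : V) (D : ℕ) (h : X.Hyperplane) :
    Lex (Fin (D - 1) → ℕ) :=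
  toLex fun i => X.rank x₀ (D - i) (X.rankClass x₀ D h i) h

/-! ### Colourings -/

/-- `k` is a predecessor of `h` whose rank-vector is maximal among all predecessors of `h`. -/
def IsMaxPredecessor (X : CubeComplex V) (x₀ : V) (D : ℕ) (k h : X.Hyperplane) : Prop :=
  X.IsPredecessor x₀ k h ∧
    ∀ j, X.IsPredecessor x₀ j h → X.rankVector x₀ D j ≤ X.rankVector x₀ D k

/-- `c` satisfies the recursion that defines the colouring: `c h = 1` if all predecessors of `h` of
maximal rank-vector are coloured `0`, and `c h = 0` otherwise. -/
def IsRankColouring (X : CubeComplex V) (x₀ : V) (D : ℕ) (c : X.Hyperplane → Fin 2) : Prop :=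
  ∀ h, ((∀ k, X.IsMaxPredecessor x₀ D k h → c k = 0) → c h = 1) ∧
    (¬ (∀ k, X.IsMaxPredecessor x₀ D k h → c k = 0) → c h = 0)

/-- The edge path `p` is an inward geodesic. -/
def IsInwardGeodesic (X : CubeComplex V) (x₀ : V) {x y : V} (p : X.graph.Walk x y) : Prop :=
  p.length = X.graph.dist x y ∧
    ∀ e ∈ p.darts, X.graph.dist x₀ e.snd < X.graph.dist x₀ e.fst

/-- The edge path `p` only crosses hyperplanes of a single colour. -/
def IsMonochromatic (X : CubeComplex V) (c : X.Hyperplane → Fin 2) {x y : V}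
    (p : X.graph.Walk x y) : Prop :=
  ∃ b : Fin 2, ∀ e ∈ p.edges, ∀ h, e ∈ X.edgesOf h → c h = b

/-- `c` is an `l`-controlled colouring: no monochromatic inward geodesic is longer than `l`. -/
def IsControlled (X : CubeComplex V) (x₀ : V) (l : ℕ) (c : X.Hyperplane → Fin 2) : Prop :=
  ∀ (x y : V) (p : X.graph.Walk x y),
    X.IsInwardGeodesic x₀ p → X.IsMonochromatic c p → p.length ≤ l

end CubeComplex

/-! The recursion is well founded, since only finitely many hyperplanes lie below a given one; hence
`c` exists and is unique.

For the bound, let `S` be the set of hyperplanes with `x` on the outward and `y` on the inward side.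
It is finite, monochromatic, closed under betweenness, and has at least as many elements as the path
has edges. An antichain in `S` consists of pairwise crossing hyperplanes that separate `x` from
`x₀`, so it has at most `D` elements. By Mirsky's theorem it remains to show that chains in `S` have
at most `3 ^ (f - 1)` elements.

By the recursion a non-minimal `h ∈ S` has a maximal predecessor `k` of the other colour, so `k ∉
S`. This `k` crosses every `g ∈ S` below `h`, and its rank-vector lies between those of `g` and `h`
(`IsRankColouring.hasEscapes`). Let a chain in `S`, with least element `a` and greatest element `b`,
lie in a class `A` of hyperplanes whose ranks above dimension `d` agree; no member of `A` lies in a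
`(d+1)`-corner bounded by `A`. If some `g` strictly between `a` and `b` had `d`-rank at least two
more than `a`, the escape `k` of `b` would lie in `A` with at least that rank, hence in a `d`-corner
bounded by hyperplanes of rank larger than that of `a`. All of these cross `a`, so adding `a` gives
a `(d+1)`-corner around `b`, a contradiction. Thus the `d`-rank takes at most three values on the
chain (`HasEscapes.card_image_rank_le`). Ranks with `d > f` vanish, so only `f - 1` ranks contribute
a factor 3, and once all ranks are fixed the chain is a single hyperplane
(`HasEscapes.card_le_one`).

The geometry behind this is derived from simple connectivity and flag links: reduced edge paths with
the same ends differ only by pushes across squares (`Reduced.swapEq`). This yields the quadrangle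
condition, and with it the description of halfspaces by distances. -/

namespace CubeComplex

variable {V : Type u} {X : CubeComplex V}

/-! ### Cubes and squares -/

namespace IsSquare

variable {a b c d : V}

theorem rotate (h : X.IsSquare a b c d) : X.IsSquare b c d a :=
  ⟨h.bc, h.cd, h.da, h.ab, h.bd, h.ac.symm, by
    have : ({b, c, d, a} : Set V) = {a, b, c, d} := by ext; simp; tauto
    rw [this]; exact h.mem⟩

theorem reflect (h : X.IsSquare a b c d) : X.IsSquare a d c b :=
  ⟨h.da.symm, h.cd.symm, h.bc.symm, h.ab.symm, h.ac, h.bd.symm, by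
    have : ({a, d, c, b} : Set V) = {a, b, c, d} := by ext; simp; tauto
    rw [this]; exact h.mem⟩

end IsSquare

theorem ncard_cube {c : Set V} (hc : c ∈ X.cubes) : ∃ n, c.ncard = 2 ^ n := by
  obtain ⟨n, φ, hφ, rfl⟩ := X.chart c hc
  refine ⟨n, ?_⟩
  rw [← Set.image_univ, Set.ncard_image_of_injective _ hφ.1, Set.ncard_univ]
  simp

theorem ncard_cube_ne_three {c : Set V} (hc : c ∈ X.cubes) : c.ncard ≠ 3 := by
  obtain ⟨n, hn⟩ := ncard_cube hc
  rw [hn]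
  rcases n with _ | _ | n
  · simp
  · simp
  · have : 0 < 2 ^ n := by positivity
    rw [pow_succ, pow_succ]; omega

/-- A cube that contains three vertices of a square contains the fourth one. -/
theorem IsSquare.mem_cube {a b c d : V} (h : X.IsSquare a b c d) {e : Set V} (he : e ∈ X.cubes)
    (ha : a ∈ e) (hb : b ∈ e) (hc : c ∈ e) : d ∈ e := by
  by_contra hd
  -- Otherwise the intersection of the two cubes would be a cube with three vertices, and three is
  -- not a power of two.
  have h1 := X.inter_mem _ h.mem _ he ⟨a, by simp, ha⟩
  have h2 : ({a, b, c, d} : Set V) ∩ e = {a, b, c} := by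
    ext x
    simp only [Set.mem_inter_iff, Set.mem_insert_iff, Set.mem_singleton_iff]
    constructor
    · rintro ⟨rfl | rfl | rfl | rfl, hx⟩ <;> simp_all
    · rintro (rfl | rfl | rfl) <;> simp_all
  rw [h2] at h1
  apply ncard_cube_ne_three h1
  rw [Set.ncard_eq_three]
  exact ⟨a, b, c, h.ab.ne, h.ac, h.bc.ne, rfl⟩

theorem IsSquare.unique {a b c d d' : V} (h : X.IsSquare a b c d) (h' : X.IsSquare a b c d') :
    d = d' := by
  have := h.mem_cube h'.mem (by simp) (by simp) (by simp)
  simp only [Set.mem_insert_iff, Set.mem_singleton_iff] at this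
  rcases this with rfl | rfl | rfl | rfl
  · exact (h.da.ne rfl).elim
  · exact (h.bd rfl).elim
  · exact (h.cd.ne rfl).elim
  · rfl

/-- The vertex of the cube `{0,1}ⁿ` that differs from `g` exactly in the coordinate `i`. -/
def flipAt {n : ℕ} (i : Fin n) (g : Fin n → Bool) : Fin n → Bool := Function.update g i (!g i)

theorem flipAt_ne {n : ℕ} (i : Fin n) (g : Fin n → Bool) : flipAt i g ≠ g := fun h => by
  have := congrFun h i
  simp [flipAt] at this

theorem flipAt_comm {n : ℕ} (i j : Fin n) (g : Fin n → Bool) :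
    flipAt i (flipAt j g) = flipAt j (flipAt i g) := by
  by_cases h : i = j
  · rw [h]
  · ext k
    simp only [flipAt, Function.update_apply]
    grind

theorem flipAt_injective {n : ℕ} (g : Fin n → Bool) {i j : Fin n}
    (h : flipAt i g = flipAt j g) : i = j := by
  by_contra hij
  have := congrFun h i
  simp [flipAt, Function.update_of_ne hij] at this

end CubeComplex

/-! ### Coordinates in a cube: edges and squares as coordinate flips. -/

namespace IsCubeChart

open CubeComplex

variable {V : Type u} {X : CubeComplex V} {n : ℕ} {φ : (Fin n → Bool) → V}

theorem face_mem (hφ : IsCubeChart X.cubes n φ) (σ : Fin n → Option Bool) :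
    φ '' {x | ∀ i b, σ i = some b → x i = b} ∈ X.cubes :=
  (hφ.2 _ (Set.image_subset_range _ _)).2 ⟨σ, rfl⟩

theorem adj_flip (hφ : IsCubeChart X.cubes n φ) (i : Fin n) (g : Fin n → Bool) :
    X.graph.Adj (φ g) (φ (flipAt i g)) := by
  refine ⟨fun h => flipAt_ne i g (hφ.1 h).symm, ?_⟩
  have := hφ.face_mem (fun k => if k = i then none else some (g k))
  convert this using 1
  rw [← Set.image_pair]
  congr 1
  ext x
  simp only [Set.mem_insert_iff, Set.mem_singleton_iff, Set.mem_ofPred_eq]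
  constructor
  · rintro (rfl | rfl) k b <;> split_ifs with hk <;> simp_all [flipAt]
  · intro hx
    have hx' : ∀ k, k ≠ i → x k = g k := fun k h1 => hx k (g k) (by simp [h1])
    rcases Bool.eq_or_eq_not (x i) (g i) with hi | hi
    · left; ext k
      by_cases hk : k = i
      · rw [hk, hi]
      · rw [hx' k hk]
    · right; ext k
      by_cases hk : k = i
      · subst hk; simp [flipAt, hi]
      · simp [hx' k hk, flipAt, hk]

theorem square_flip (hφ : IsCubeChart X.cubes n φ) {i j : Fin n} (hij : i ≠ j) (g : Fin n → Bool) :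
    X.IsSquare (φ g) (φ (flipAt i g)) (φ (flipAt j (flipAt i g))) (φ (flipAt j g)) := by
  have hji := hij.symm
  refine ⟨hφ.adj_flip _ _, hφ.adj_flip _ _, ?_, (hφ.adj_flip _ _).symm, ?_, ?_, ?_⟩
  · rw [flipAt_comm]; exact (hφ.adj_flip _ _).symm
  · intro h
    have := congrFun (hφ.1 h) i
    simp [flipAt, hij] at this
  · intro h
    exact hij (flipAt_injective g (hφ.1 h))
  · have := hφ.face_mem (fun k => if k = i ∨ k = j then none else some (g k))
    convert this using 1
    have h4 : ({φ g, φ (flipAt i g), φ (flipAt j (flipAt i g)), φ (flipAt j g)} : Set V) =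
      φ '' {g, flipAt i g, flipAt j (flipAt i g), flipAt j g} := by simp [Set.image_insert_eq]
    rw [h4]
    congr 1
    ext x
    simp only [Set.mem_insert_iff, Set.mem_singleton_iff, Set.mem_ofPred_eq]
    constructor
    · rintro (rfl | rfl | rfl | rfl) k b <;> split_ifs with hk <;> simp_all [flipAt, not_or]
    · intro hx
      have hx' : ∀ k, k ≠ i → k ≠ j → x k = g k := fun k h1 h2 => hx k (g k) (by simp [h1, h2])
      have hcase : ∀ y : Fin n → Bool, y i = x i → y j = x j →
          (∀ k, k ≠ i → k ≠ j → y k = g k) → x = y := by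
        intro y h1 h2 h3
        ext k
        by_cases hk : k = i
        · rw [hk, h1]
        by_cases hk' : k = j
        · rw [hk', h2]
        rw [hx' k hk hk', h3 k hk hk']
      rcases Bool.eq_or_eq_not (x i) (g i) with hi | hi <;>
        rcases Bool.eq_or_eq_not (x j) (g j) with hj | hj
      · left; apply hcase <;> simp [*]
      · right; right; right; apply hcase <;> simp +contextual [flipAt, *]
      · right; left; apply hcase <;> simp +contextual [flipAt, *]
      · right; right; left; apply hcase <;> simp +contextual [flipAt, *]

theorem exists_flip (hφ : IsCubeChart X.cubes n φ) {g : Fin n → Bool} {w : V}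
    (hw : w ∈ Set.range φ) (h : X.graph.Adj (φ g) w) : ∃ i, w = φ (flipAt i g) := by
  obtain ⟨g', rfl⟩ := hw
  have hne : g' ≠ g := fun e => h.1 (by rw [e])
  obtain ⟨σ, hσ⟩ := (hφ.2 _ (by
    rintro _ (rfl | rfl)
    · exact ⟨_, rfl⟩
    · exact ⟨_, rfl⟩)).1 h.2
  rw [← Set.image_pair] at hσ
  have hσ' := hφ.1.image_injective hσ
  obtain ⟨i, hi⟩ := Function.ne_iff.1 hne
  have hg : ∀ i b, σ i = some b → g i = b := by
    have : g ∈ ({g, g'} : Set _) := by simp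
    rwa [hσ'] at this
  have hg' : ∀ i b, σ i = some b → g' i = b := by
    have : g' ∈ ({g, g'} : Set _) := by simp
    rwa [hσ'] at this
  -- The face `{g, g'}` leaves free every coordinate where `g` and `g'` differ, so it also contains
  -- the flip of `g` at one such coordinate, which must then be `g'`.
  have hf : flipAt i g ∈ ({g, g'} : Set _) := by
    rw [hσ']
    intro k b hk
    by_cases hki : k = i
    · subst hki
      exact (hi ((hg' k b hk).trans (hg k b hk).symm)).elim
    · simpa [flipAt, hki] using hg k b hk
  rcases hf with hf | hf
  · exact (flipAt_ne i g hf).elim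
  · exact ⟨i, by rw [hf]⟩

end IsCubeChart

namespace CubeComplex

variable {V : Type u} {X : CubeComplex V}

open Classical in
/-- Three squares at a vertex `w` that pairwise share an edge span a 3-cube. -/
theorem IsCAT0.exists_cube (hX : X.IsCAT0) {w x y y' v z t : V} (h1 : X.IsSquare w x v y)
    (h2 : X.IsSquare w x z y') (h3 : X.IsSquare w y t y') :
    ∃ s, X.IsSquare x v s z ∧ X.IsSquare y v s t ∧ X.IsSquare y' z s t := by
  have hpair : ∀ {a b c : V}, X.IsSquare w a c b → X.IsLinkSimplex w {a, b} := by
    intro a b c h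
    refine ⟨?_, _, h.mem, by simp, ?_⟩
    · intro e he
      simp only [Finset.mem_insert, Finset.mem_singleton] at he
      rcases he with rfl | rfl
      · exact h.ab
      · exact h.da.symm
    · intro e; simp; tauto
  have hsing : ∀ {a : V}, X.graph.Adj w a → X.IsLinkSimplex w {a, a} := by
    intro a h
    exact ⟨by simpa using h, _, h.2, by simp, by simp⟩
  obtain ⟨-, c, hc, hwc, hS⟩ := hX.2 w {x, y, y'} (by
    intro a ha b hb
    simp only [Finset.mem_insert, Finset.mem_singleton] at ha hb
    rcases ha with rfl | rfl | rfl <;> rcases hb with rfl | rfl | rfl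
    · exact hsing h1.ab
    · exact hpair h1
    · exact hpair h2
    · exact hpair h1.reflect
    · exact hsing h3.ab
    · exact hpair h3
    · exact hpair h2.reflect
    · exact hpair h3.reflect
    · exact hsing h3.da.symm)
  obtain ⟨n, φ, hφ, rfl⟩ := X.chart c hc
  obtain ⟨g, rfl⟩ := hwc
  obtain ⟨i, rfl⟩ := hφ.exists_flip (hS (by simp)) h1.ab
  obtain ⟨j, rfl⟩ := hφ.exists_flip (hS (by simp)) h3.ab
  obtain ⟨k, rfl⟩ := hφ.exists_flip (hS (by simp)) h3.da.symm
  have hij : i ≠ j := by rintro rfl; exact h1.bd rfl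
  have hik : i ≠ k := by rintro rfl; exact h2.bd rfl
  have hjk : j ≠ k := by rintro rfl; exact h3.bd rfl
  have key : ∀ {i j : Fin n} {v : V}, i ≠ j → X.IsSquare (φ g) (φ (flipAt i g)) v (φ (flipAt j g)) →
      v = φ (flipAt j (flipAt i g)) := by
    intro i j v hij h
    exact h.reflect.rotate.reflect.unique (hφ.square_flip hij g).reflect.rotate.reflect
  obtain rfl := key hij h1
  obtain rfl := key hik h2
  obtain rfl := key hjk h3
  refine ⟨φ (flipAt k (flipAt j (flipAt i g))), hφ.square_flip hjk _, ?_, ?_⟩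
  · have := hφ.square_flip hik (flipAt j g)
    rwa [flipAt_comm i j] at this
  · have := hφ.square_flip hij (flipAt k g)
    rwa [flipAt_comm i k, flipAt_comm j k (flipAt i g), flipAt_comm j k g] at this

end CubeComplex

namespace CubeComplex

variable {V : Type u} {X : CubeComplex V}

open SimpleGraph

/-! ### Reduced edge paths -/

/-- Two edge paths are equivalent if they differ by pushing across squares, in a form that records
the first square. -/
inductive SwapEq (X : CubeComplex V) : ∀ {x u : V}, X.graph.Walk x u → X.graph.Walk x u → Prop
  | nil {u : V} : SwapEq X (.nil : X.graph.Walk u u) .nil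
  | cons {x v u : V} (h : X.graph.Adj x v) {p q : X.graph.Walk v u} :
      SwapEq X p q → SwapEq X (.cons h p) (.cons h q)
  | swap {x v y w u : V} (s : X.IsSquare x v y w) {p : X.graph.Walk v u} {q : X.graph.Walk w u}
      (r : X.graph.Walk y u) : SwapEq X p (.cons s.bc r) → SwapEq X q (.cons s.cd.symm r) →
      SwapEq X (.cons s.ab p) (.cons s.da.symm q)

namespace SwapEq

variable {x u v w : V}

theorem refl (p : X.graph.Walk x u) : X.SwapEq p p := by
  induction p with
  | nil => exact .nil
  | cons h p ih => exact .cons h ih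

theorem symm {p q : X.graph.Walk x u} (h : X.SwapEq p q) : X.SwapEq q p := by
  induction h with
  | nil => exact .nil
  | cons h _ ih => exact .cons h ih
  | swap s r h1 h2 => exact .swap s.reflect r h2 h1

theorem length_eq {p q : X.graph.Walk x u} (h : X.SwapEq p q) : p.length = q.length := by
  induction h with
  | nil => rfl
  | cons h _ ih => simp [ih]
  | swap s r h1 h2 ih1 ih2 => simp_all

/-- Transitivity is where flagness enters. If both equivalences begin with a push and the two
squares differ, comparing the tails of `q` gives a third square at `w`. The three squares span a
3-cube, and pushing across its other three faces relates `p` to `r`. -/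
theorem trans_aux (hX : X.IsCAT0) (n : ℕ) : ∀ {x u : V} {p q r : X.graph.Walk x u}, q.length = n →
    X.SwapEq p q → X.SwapEq q r → X.SwapEq p r := by
  induction n with
  | zero =>
    intro x u p q r hn h1 h2
    cases h1 with
    | nil => exact h2
    | cons => simp at hn
    | swap => simp at hn
  | succ n ih =>
    intro x u p q r hn h1 h2
    cases h1 with
    | nil => exact h2
    | cons h h1 =>
      cases h2 with
      | cons _ h2 => exact .cons _ (ih (by simpa using hn) h1 h2)
      | swap s r' h2 h3 => exact .swap s r' (ih (by simpa using hn) h1 h2) h3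
    | @swap _ v y w _ s1 p q r1 hp hq =>
      have hl : q.length = n := by simpa using hn
      have hr1 : (Walk.cons s1.cd.symm r1).length = n := hq.length_eq ▸ hl
      cases h2 with
      | cons _ h2 =>
        exact .swap s1 r1 hp (ih hl h2.symm hq)
      | @swap _ _ y' z _ s2 _ s r2 hq' hs =>
        have hr := ih hl hq.symm hq'
        have hpl := hp.length_eq
        have hsl := hs.length_eq
        have hql := hq.length_eq
        have hql' := hq'.length_eq
        simp only [Walk.length_cons] at hpl hsl hql hql'
        generalize hα : Walk.cons s1.cd.symm r1 = α at hr
        generalize hβ : Walk.cons s2.bc r2 = β at hr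
        cases hr with
        | nil => cases hα
        | cons h hr =>
          cases hα
          cases hβ
          -- Both pushes use the same square, so the second undoes the first.
          obtain rfl := s1.reflect.unique s2
          exact .cons _ (ih (by simp only [Walk.length_cons]; omega)
            (ih (by simp; omega) hp (.cons s1.bc hr)) hs.symm)
        | @swap _ _ t _ _ s3 _ _ r3 h3 h4 =>
          cases hα
          cases hβ
          obtain ⟨m, c1, c2, c3⟩ := 
            hX.exists_cube s1.rotate.rotate.rotate s2.rotate.reflect s3
          have e3 := h3.length_eq
          have e4 := h4.length_eq
          simp only [Walk.length_cons] at e3 e4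
          refine .swap c1 (.cons c2.cd r3) ?_ ?_
          · refine ih (by simp; omega) (ih (by simp; omega) hp (.cons _ h3)) ?_
            exact .swap c2.rotate.reflect r3 (refl _) (refl _)
          · refine ih (by simp; omega) (ih (by simp; omega) hs (.cons _ h4)) ?_
            exact .swap c3.rotate.reflect r3 (refl _) (refl _)

theorem trans (hX : X.IsCAT0) {p q r : X.graph.Walk x u} (h1 : X.SwapEq p q) (h2 : X.SwapEq q r) :
    X.SwapEq p r := trans_aux hX _ rfl h1 h2

theorem of_cons {h : X.graph.Adj x v} {p q : X.graph.Walk v u}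
    (hpq : X.SwapEq (.cons h p) (.cons h q)) : X.SwapEq p q := by
  cases hpq with
  | cons _ h => exact h
  | swap s => exact (s.bd rfl).elim

theorem exists_square {h : X.graph.Adj x v} {h' : X.graph.Adj x w} {p : X.graph.Walk v u}
    {q : X.graph.Walk w u} (hpq : X.SwapEq (.cons h p) (.cons h' q)) (hvw : v ≠ w) :
    ∃ (y : V) (s : X.IsSquare x v y w) (r : X.graph.Walk y u),
      X.SwapEq p (.cons s.bc r) ∧ X.SwapEq q (.cons s.cd.symm r) := by
  cases hpq with
  | cons _ h => exact (hvw rfl).elim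
  | swap s r h1 h2 => exact ⟨_, s, r, h1, h2⟩

end SwapEq

/-- An edge path is reduced if it admits no backtrack, even after pushing it across squares. -/
def Reduced (X : CubeComplex V) : ∀ {x u : V}, X.graph.Walk x u → Prop
  | _, _, .nil => True
  | _, _, .cons h p => Reduced X p ∧ ∀ q, ¬ X.SwapEq p (.cons h.symm q)

/-- A backtrack after the push either gives, by one more push, a backtrack along the edge from `x`
to `v`, or uses the square `s` itself and so comes from a backtrack along the edge from `v` to `y`.
-/
theorem Reduced.swap (hX : X.IsCAT0) {x v y w u : V} (s : X.IsSquare x v y w)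
    {p : X.graph.Walk v u} {q : X.graph.Walk w u} {r : X.graph.Walk y u}
    (h1 : X.SwapEq p (.cons s.bc r)) (h2 : X.SwapEq q (.cons s.cd.symm r))
    (ih1 : X.Reduced p ↔ X.Reduced (.cons s.bc r))
    (ih2 : X.Reduced q ↔ X.Reduced (.cons s.cd.symm r))
    (hp : X.Reduced (.cons s.ab p)) : X.Reduced (.cons s.da.symm q) := by
  refine ⟨ih2.2 ⟨(ih1.1 hp.1).1, fun r' hr => ?_⟩, fun q' hq' => ?_⟩
  · refine hp.2 (.cons s.da.symm r') (h1.trans hX (.trans hX (.cons _ hr) ?_))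
    exact .swap s.rotate r' (.refl _) (.refl _)
  · obtain ⟨t, s', r', h3, h4⟩ := (h2.symm.trans hX hq').exists_square s.ac.symm
    obtain rfl := s.reflect.unique s'.rotate.rotate.rotate
    exact (ih1.1 hp.1).2 r' h3

theorem reduced_congr (hX : X.IsCAT0) {x u : V} {p q : X.graph.Walk x u} (h : X.SwapEq p q) :
    X.Reduced p ↔ X.Reduced q := by
  induction h with
  | nil => exact Iff.rfl
  | cons h hpq ih =>
    exact and_congr ih (forall_congr' fun r => not_congr ⟨hpq.symm.trans hX, hpq.trans hX⟩)
  | swap s r h1 h2 ih1 ih2 =>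
    exact ⟨.swap hX s h1 h2 ih1 ih2, .swap hX s.reflect h2 h1 ih2 ih1⟩

open Classical in
/-- The action of an edge on (reduced) edge paths: prepend it and cancel a backtrack, if any. -/
noncomputable def prepend (X : CubeComplex V) {x v u : V} (h : X.graph.Adj x v)
    (p : X.graph.Walk v u) : X.graph.Walk x u :=
  if hp : ∃ q, X.SwapEq p (.cons h.symm q) then hp.choose else .cons h p

/-! ### Edges act on reduced paths modulo squares. -/

section prepend

variable {x v u : V}

theorem prepend_of_swapEq (hX : X.IsCAT0) (h : X.graph.Adj x v) {p : X.graph.Walk v u}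
    {q : X.graph.Walk x u} (hq : X.SwapEq p (.cons h.symm q)) : X.SwapEq (X.prepend h p) q := by
  have hp : ∃ q, X.SwapEq p (.cons h.symm q) := ⟨q, hq⟩
  rw [prepend, dif_pos hp]
  exact (hp.choose_spec.symm.trans hX hq).of_cons

theorem prepend_of_reduced {h : X.graph.Adj x v} {p : X.graph.Walk v u}
    (hp : X.Reduced (.cons h p)) : X.prepend h p = .cons h p := by
  rw [prepend, dif_neg]
  rintro ⟨q, hq⟩
  exact hp.2 q hq

theorem prepend_cases (hX : X.IsCAT0) (h : X.graph.Adj x v) {p : X.graph.Walk v u}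
    (hp : X.Reduced p) :
    (∃ q, X.SwapEq p (.cons h.symm q) ∧ X.SwapEq (X.prepend h p) q ∧ X.Reduced q) ∨
      (X.Reduced (.cons h p) ∧ X.prepend h p = .cons h p) := by
  by_cases hq : ∃ q, X.SwapEq p (.cons h.symm q)
  · obtain ⟨q, hq⟩ := hq
    exact .inl ⟨q, hq, prepend_of_swapEq hX h hq, ((reduced_congr hX hq).1 hp).1⟩
  · have := And.intro hp (not_exists.1 hq)
    exact .inr ⟨this, prepend_of_reduced this⟩

theorem reduced_prepend (hX : X.IsCAT0) (h : X.graph.Adj x v) {p : X.graph.Walk v u}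
    (hp : X.Reduced p) : X.Reduced (X.prepend h p) := by
  rcases prepend_cases hX h hp with ⟨q, -, h1, h2⟩ | ⟨h1, h2⟩
  · exact (reduced_congr hX h1).2 h2
  · rwa [h2]

theorem prepend_congr (hX : X.IsCAT0) (h : X.graph.Adj x v) {p q : X.graph.Walk v u}
    (hp : X.Reduced p) (hpq : X.SwapEq p q) : X.SwapEq (X.prepend h p) (X.prepend h q) := by
  rcases prepend_cases hX h hp with ⟨r, h1, h2, -⟩ | ⟨h1, h2⟩
  · exact h2.trans hX (prepend_of_swapEq hX h (hpq.symm.trans hX h1)).symm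
  · have := (reduced_congr hX (.cons h hpq)).1 h1
    rw [h2, prepend_of_reduced this]
    exact .cons h hpq

theorem prepend_backtrack (hX : X.IsCAT0) (h : X.graph.Adj x v) {p : X.graph.Walk x u}
    (hp : X.Reduced p) : X.SwapEq (X.prepend h (X.prepend h.symm p)) p := by
  have hp' := reduced_prepend hX h.symm hp
  rcases prepend_cases hX h.symm hp with ⟨r, h1, h2, -⟩ | ⟨h1, h2⟩
  · refine (prepend_congr hX h hp' h2).trans hX ?_
    rw [prepend_of_reduced ((reduced_congr hX h1).1 hp)]
    exact h1.symm
  · rw [h2]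
    exact prepend_of_swapEq hX h (.refl _)

theorem prepend_square_of_swapEq (hX : X.IsCAT0) {a b c d : V} (s : X.IsSquare a b c d)
    {p : X.graph.Walk c u} {q : X.graph.Walk b u} (hp : X.Reduced p)
    (hq : X.SwapEq p (.cons s.bc.symm q)) :
    X.SwapEq (X.prepend s.ab (X.prepend s.bc p))
      (X.prepend s.da.symm (X.prepend s.cd.symm p)) := by
  have hqr := ((reduced_congr hX hq).1 hp).1
  refine (prepend_congr hX _ (reduced_prepend hX _ hp) (prepend_of_swapEq hX s.bc hq)).trans hX ?_
  rcases prepend_cases hX s.ab hqr with ⟨r, h1, h2, -⟩ | ⟨h1, h2⟩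
  · refine h2.trans hX (.symm ?_)
    have h3 : X.SwapEq p (.cons s.cd (.cons s.da r)) :=
      hq.trans hX (.trans hX (.cons _ h1) (.swap s.reflect.rotate.rotate r (.refl _) (.refl _)))
    exact (prepend_congr hX _ (reduced_prepend hX _ hp) (prepend_of_swapEq hX s.cd.symm h3)).trans
      hX (prepend_of_swapEq hX _ (.refl _))
  · rw [h2]
    rcases prepend_cases hX s.cd.symm hp with ⟨q', h3, -⟩ | ⟨h3, h4⟩
    · obtain ⟨t, s', r, h5, -⟩ := (hq.symm.trans hX h3).exists_square s.bd
      obtain rfl := s.rotate.unique s'.reflect.rotate.rotate.rotate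
      exact (h1.2 _ h5).elim
    · rw [h4]
      refine (prepend_of_swapEq hX _ ?_).symm
      refine SwapEq.trans hX (.cons s.cd.symm hq) ?_
      exact .swap s.reflect.rotate q (.refl _) (.refl _)

/-- The two sides of a square act alike. If neither edge at `c` cancels, then nothing cancels at
all: a backtrack at `a` would pass through the same square and so cancel the other edge at `c`. -/
theorem prepend_square (hX : X.IsCAT0) {a b c d : V} (s : X.IsSquare a b c d)
    {p : X.graph.Walk c u} (hp : X.Reduced p) :
    X.SwapEq (X.prepend s.ab (X.prepend s.bc p))
      (X.prepend s.da.symm (X.prepend s.cd.symm p)) := by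
  rcases prepend_cases hX s.bc hp with ⟨q, h1, -⟩ | ⟨h1, h2⟩
  · exact prepend_square_of_swapEq hX s hp h1
  rcases prepend_cases hX s.cd.symm hp with ⟨q, h3, -⟩ | ⟨h3, h4⟩
  · exact (prepend_square_of_swapEq hX s.reflect hp h3).symm
  have key : ∀ {b d : V} (s : X.IsSquare a b c d), X.Reduced (.cons s.bc p) →
      X.Reduced (.cons s.cd.symm p) → X.Reduced (.cons s.ab (.cons s.bc p)) := by
    intro b d s h1 h3
    refine ⟨h1, fun r hr => ?_⟩
    obtain ⟨t, s', r', h5, -⟩ := hr.exists_square s.ac.symm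
    obtain rfl := s.unique s'.rotate.rotate.rotate
    exact h3.2 _ h5
  have h5 := key s h1 h3
  have h6 := key s.reflect h3 h1
  rw [h2, h4, prepend_of_reduced h5, prepend_of_reduced h6]
  exact .swap s p (.refl _) (.refl _)

end prepend

/-! ### Normal forms and geodesics -/

/-- A reduced edge path homotopic to a given one. -/
noncomputable def normalForm (X : CubeComplex V) :
    ∀ {x u : V}, X.graph.Walk x u → X.graph.Walk x u
  | _, _, .nil => .nil
  | _, _, .cons h p => X.prepend h (normalForm X p)

section normalForm

variable {x u v w : V}

theorem reduced_normalForm (hX : X.IsCAT0) (p : X.graph.Walk x u) :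
    X.Reduced (X.normalForm p) := by
  induction p with
  | nil => trivial
  | cons h p ih => exact reduced_prepend hX h ih

theorem Reduced.normalForm_eq {p : X.graph.Walk x u} (hp : X.Reduced p) : X.normalForm p = p := by
  induction p with
  | nil => rfl
  | cons h p ih => rw [normalForm, ih hp.1, prepend_of_reduced hp]

/-- Van der Waerden's trick: prepending respects the defining moves of homotopy on reduced paths
modulo squares, so the result of letting a whole path act depends only on its homotopy class. -/
theorem Homotopic.normalForm (hX : X.IsCAT0) {p q : X.graph.Walk x u} (h : X.Homotopic p q) :
    X.SwapEq (X.normalForm p) (X.normalForm q) := by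
  induction h with
  | refl p => exact .refl _
  | symm _ ih => exact ih.symm
  | trans _ _ ih1 ih2 => exact ih1.trans hX ih2
  | cons h _ ih => exact prepend_congr hX h (reduced_normalForm hX _) ih
  | backtrack h p => exact prepend_backtrack hX h (reduced_normalForm hX p)
  | square h p => exact prepend_square hX h (reduced_normalForm hX p)

/-- With simple connectivity this makes the 1-skeleton bipartite, which is what excludes equality in
`dist_adj`. -/
theorem Homotopic.even_length {p q : X.graph.Walk x u} (h : X.Homotopic p q) :
    Even p.length ↔ Even q.length := by
  induction h with
  | refl p => rfl
  | symm _ ih => exact ih.symm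
  | trans _ _ ih1 ih2 => exact ih1.trans ih2
  | cons h _ ih => simp [Nat.even_add_one, ih]
  | backtrack h p => simp [Nat.even_add_one]
  | square h p => simp

theorem Homotopic.append {p q : X.graph.Walk x v} (h : X.Homotopic p q) (r : X.graph.Walk v u) :
    X.Homotopic (p.append r) (q.append r) := by
  induction h with
  | refl p => exact .refl _
  | symm _ ih => exact (ih r).symm
  | trans _ _ ih1 ih2 => exact (ih1 r).trans (ih2 r)
  | cons h _ ih => exact .cons h (ih r)
  | backtrack h p => exact .backtrack h (p.append r)
  | square h p => exact .square h (p.append r)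

theorem Homotopic.append_left {p q : X.graph.Walk v u} (h : X.Homotopic p q)
    (r : X.graph.Walk x v) : X.Homotopic (r.append p) (r.append q) := by
  induction r with
  | nil => exact h
  | cons e r ih => exact .cons e (ih h)

theorem SimplyConnected.homotopic (hX : X.SimplyConnected) (p q : X.graph.Walk x u) :
    X.Homotopic p q := by
  have h1 := (hX.2 x (p.append q.reverse)).append q
  have h2 := (hX.2 u (q.reverse.append q)).append_left p
  rw [Walk.append_nil, Walk.append_assoc] at h2
  exact h2.symm.trans h1

theorem Reduced.swapEq (hX : X.IsCAT0) {p q : X.graph.Walk x u} (hp : X.Reduced p)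
    (hq : X.Reduced q) : X.SwapEq p q := by
  have := (hX.1.homotopic p q).normalForm hX
  rwa [hp.normalForm_eq, hq.normalForm_eq] at this

theorem reduced_of_length_eq_dist (hX : X.IsCAT0) {p : X.graph.Walk x u}
    (hp : p.length = X.graph.dist x u) : X.Reduced p := by
  induction p with
  | nil => trivial
  | @cons x v u h p ih =>
    have hp' : p.length = X.graph.dist v u := by
      have h1 := dist_le p
      obtain ⟨q, hq⟩ := (hX.1.1.preconnected v u).exists_walk_length_eq_dist
      have h2 := dist_le (.cons h q)
      simp only [Walk.length_cons] at hp h2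
      omega
    refine ⟨ih hp', fun q hq => ?_⟩
    have h1 := dist_le q
    have h2 := hq.length_eq
    simp only [Walk.length_cons] at hp h2
    omega

/-- The distances to a vertex of the two ends of an edge differ by exactly one. -/
theorem dist_adj (hX : X.IsCAT0) (h : X.graph.Adj x v) (u : V) :
    X.graph.dist x u = X.graph.dist v u + 1 ∨ X.graph.dist v u = X.graph.dist x u + 1 := by
  obtain ⟨p, hp⟩ := (hX.1.1.preconnected x u).exists_walk_length_eq_dist
  obtain ⟨q, hq⟩ := (hX.1.1.preconnected v u).exists_walk_length_eq_dist
  have h1 := dist_le (.cons h q)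
  have h2 := dist_le (.cons h.symm p)
  have h3 := (hX.1.homotopic p (.cons h q)).even_length
  simp only [Walk.length_cons, Nat.even_add_one] at h1 h2 h3
  rcases lt_trichotomy p.length q.length with h | h | h
  · omega
  · rw [h] at h3; tauto
  · omega

/-- The quadrangle condition. -/
theorem exists_square_of_dist (hX : X.IsCAT0) (hv : X.graph.Adj x v) (hw : X.graph.Adj x w)
    (hvw : v ≠ w) (hdv : X.graph.dist v u < X.graph.dist x u)
    (hdw : X.graph.dist w u < X.graph.dist x u) :
    ∃ y, X.IsSquare x v y w ∧ X.graph.dist y u < X.graph.dist v u := by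
  obtain ⟨p, hp⟩ := (hX.1.1.preconnected v u).exists_walk_length_eq_dist
  obtain ⟨q, hq⟩ := (hX.1.1.preconnected w u).exists_walk_length_eq_dist
  have h1 := dist_adj hX hv u
  have h2 := dist_adj hX hw u
  have h3 := reduced_of_length_eq_dist (p := .cons hv p) hX (by simp only [Walk.length_cons]; omega)
  have h4 := reduced_of_length_eq_dist (p := .cons hw q) hX (by simp only [Walk.length_cons]; omega)
  -- The geodesics from `x` through `v` and through `w` are both reduced, hence equivalent; the
  -- first square of the equivalence is the required one.
  obtain ⟨y, s, r, h5, -⟩ := (h3.swapEq hX h4).exists_square hvw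
  refine ⟨y, s, ?_⟩
  have h6 := h5.length_eq
  have := dist_le r
  simp only [Walk.length_cons] at h6
  omega

end normalForm

end CubeComplex

namespace CubeComplex

variable {V : Type u} {X : CubeComplex V}

open SimpleGraph

/-! ### Hyperplanes and halfspaces -/

/-- The hyperplane dual to an edge. -/
def dual (X : CubeComplex V) {x y : V} (h : X.graph.Adj x y) : X.Hyperplane :=
  Quot.mk _ ⟨s(x, y), h⟩

theorem dual_symm {x y : V} (h : X.graph.Adj x y) : X.dual h.symm = X.dual h := by
  unfold dual
  congr 2
  exact Sym2.eq_swap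

theorem IsSquare.dual_eq {a b c d : V} (s : X.IsSquare a b c d) :
    X.dual s.ab = X.dual s.cd.symm :=
  Quot.sound ⟨a, b, c, d, s, rfl, rfl⟩

theorem mem_edgesOf {x y : V} (h : X.graph.Adj x y) (k : X.Hyperplane) :
    s(x, y) ∈ X.edgesOf k ↔ X.dual h = k :=
  ⟨fun ⟨_, h⟩ => h, fun e => ⟨h, e⟩⟩

theorem dist_lt_or (hX : X.IsCAT0) {x y : V} (h : X.graph.Adj x y) (u : V) :
    ¬ X.graph.dist x u < X.graph.dist y u ↔ X.graph.dist y u < X.graph.dist x u := by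
  have := dist_adj hX h u
  omega

/-- If opposite edges pointed in different directions, parity would make `b` and `d` both farther
from `u` than `a` and `c`. The quadrangle condition at `b` would then complete the square by a
vertex nearer than `a`, but the fourth vertex is `d`. -/
theorem IsSquare.dist_lt (hX : X.IsCAT0) {a b c d : V} (s : X.IsSquare a b c d) {u : V}
    (h : X.graph.dist a u < X.graph.dist b u) : X.graph.dist d u < X.graph.dist c u := by
  by_contra hdc
  rw [dist_lt_or hX s.cd.symm] at hdc
  have h1 := dist_adj hX s.ab u
  have h2 := dist_adj hX s.bc u
  have h3 := dist_adj hX s.cd u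
  have h4 := dist_adj hX s.da u
  obtain ⟨y, s', hy⟩ := exists_square_of_dist hX s.ab.symm s.bc s.ac h (by omega)
  obtain rfl := s.reflect.rotate.rotate.unique s'.rotate.rotate.rotate
  omega

/-- The halfspaces of parallel edges agree, up to orientation. -/
theorem dist_lt_of_eqvGen (hX : X.IsCAT0) {e e' : X.graph.edgeSet}
    (h : Relation.EqvGen X.Opposite e e') : ∀ {x y z w : V}, e.1 = s(x, y) → e'.1 = s(z, w) →
      (∀ u, X.graph.dist x u < X.graph.dist y u ↔ X.graph.dist z u < X.graph.dist w u) ∨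
      (∀ u, X.graph.dist x u < X.graph.dist y u ↔ X.graph.dist w u < X.graph.dist z u) := by
  induction h with
  | rel e e' h =>
    intro x y z w he he'
    obtain ⟨a, b, c, d, s, h1, h2⟩ := h
    have h3 : ∀ u, X.graph.dist a u < X.graph.dist b u ↔ X.graph.dist d u < X.graph.dist c u :=
      fun u => ⟨s.dist_lt hX, s.reflect.rotate.dist_lt hX⟩
    have h4 : ∀ u, X.graph.dist b u < X.graph.dist a u ↔ X.graph.dist c u < X.graph.dist d u :=
      fun u => by rw [← dist_lt_or hX s.ab, h3, dist_lt_or hX s.cd.symm]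
    rw [he, Sym2.eq_iff] at h1
    rw [he', Sym2.eq_iff] at h2
    obtain ⟨rfl, rfl⟩ | ⟨rfl, rfl⟩ := h1 <;> obtain ⟨rfl, rfl⟩ | ⟨rfl, rfl⟩ := h2
    · exact .inl h3
    · exact .inr h3
    · exact .inr h4
    · exact .inl h4
  | refl e =>
    intro x y z w he he'
    rw [he, Sym2.eq_iff] at he'
    obtain ⟨rfl, rfl⟩ | ⟨rfl, rfl⟩ := he'
    · exact .inl fun _ => Iff.rfl
    · exact .inr fun _ => Iff.rfl
  | symm e e' _ ih =>
    intro x y z w he he'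
    have h1 : X.graph.Adj x y := by have := e'.2; rwa [he] at this
    have h2 : X.graph.Adj z w := by have := e.2; rwa [he'] at this
    rcases ih he' he with h | h
    · exact .inl fun u => (h u).symm
    · refine .inr fun u => ?_
      rw [← dist_lt_or hX h1.symm, ← h, dist_lt_or hX h2]
  | trans e e' e'' _ _ ih1 ih2 =>
    intro x y z w he he'
    obtain ⟨⟨a, b⟩, hab⟩ := e'
    have hab' : X.graph.Adj a b := hab
    rcases ih1 he rfl with h1 | h1 <;> rcases ih2 rfl he' with h2 | h2
    · exact .inl fun u => (h1 u).trans (h2 u)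
    · exact .inr fun u => (h1 u).trans (h2 u)
    · have hzw : X.graph.Adj z w := by have := e''.2; rwa [he'] at this
      exact .inr fun u => by rw [h1, ← dist_lt_or hX hab', h2, dist_lt_or hX hzw]
    · have hzw : X.graph.Adj z w := by have := e''.2; rwa [he'] at this
      exact .inl fun u => by rw [h1, ← dist_lt_or hX hab', h2, dist_lt_or hX hzw.symm]

theorem dist_lt_of_dual_eq (hX : X.IsCAT0) {x y z w : V} {h : X.graph.Adj x y}
    {h' : X.graph.Adj z w} (e : X.dual h = X.dual h') :
      (∀ u, X.graph.dist x u < X.graph.dist y u ↔ X.graph.dist z u < X.graph.dist w u) ∨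
      (∀ u, X.graph.dist x u < X.graph.dist y u ↔ X.graph.dist w u < X.graph.dist z u) :=
  dist_lt_of_eqvGen hX (Quot.eqvGen_exact e) rfl rfl

theorem exists_adj_dist_lt (hX : X.IsCAT0) {x u : V} (h : x ≠ u) :
    ∃ v, X.graph.Adj x v ∧ X.graph.dist v u < X.graph.dist x u := by
  obtain ⟨p, hp⟩ := (hX.1.1.preconnected x u).exists_walk_length_eq_dist
  cases p with
  | nil => exact (h rfl).elim
  | cons e p =>
    refine ⟨_, e, ?_⟩
    have := dist_le p
    simp only [Walk.length_cons] at hp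
    omega

/-- An edge that is separated by the halfspaces of `s(x, y)` is parallel to `s(x, y)`. -/
theorem dual_eq_of_dist_lt (hX : X.IsCAT0) {x y : V} (h : X.graph.Adj x y) (n : ℕ) :
    ∀ {z w : V} (h' : X.graph.Adj z w), X.graph.dist x z = n →
      X.graph.dist x z < X.graph.dist y z → X.graph.dist y w < X.graph.dist x w →
      X.dual h = X.dual h' := by
  have hc : ∀ u v, X.graph.dist u v = X.graph.dist v u := fun _ _ => dist_comm
  induction n with
  | zero =>
    intro z w h' hn h1 h2
    obtain rfl := (hX.1.1.dist_eq_zero_iff).1 hn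
    have h3 := dist_adj hX h' x
    have h4 := dist_adj hX h' y
    have h5 : X.graph.dist x x = 0 := SimpleGraph.dist_self
    have h6 := dist_adj hX h x
    have h7 := hc w x
    have h8 := hc w y
    obtain rfl := (hX.1.1.dist_eq_zero_iff).1 (show X.graph.dist y w = 0 by omega)
    rfl
  | succ n ih =>
    intro z w h' hn h1 h2
    have hzx : z ≠ x := by
      rintro rfl
      rw [SimpleGraph.dist_self] at hn
      omega
    obtain ⟨z', hz', hd⟩ := exists_adj_dist_lt hX hzx
    have := dist_adj hX h z
    have := dist_adj hX h w
    have := dist_adj hX h z'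
    have := dist_adj hX hz' x
    have := dist_adj hX hz' y
    have := dist_adj hX h' x
    have := dist_adj hX h' y
    simp only [hc _ x, hc _ y] at *
    have hne : z' ≠ w := by rintro rfl; omega
    -- Both `z'` and `w` are nearer to `y` than `z` is. The quadrangle condition therefore gives a
    -- parallel edge from `z'` to `w'`, which is one step nearer to `x`.
    obtain ⟨w', s, hw'⟩ := exists_square_of_dist (u := y) hX hz' h' hne
      (by simp only [hc _ y]; omega) (by simp only [hc _ y]; omega)
    have := dist_adj hX s.bc x
    have := dist_adj hX s.bc y
    have := dist_adj hX h w'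
    have := dist_adj hX s.cd x
    simp only [hc _ x, hc _ y] at *
    have e1 := ih s.bc (by omega) (by omega) (by omega)
    have e2 := s.rotate.dual_eq
    rw [e1, e2]

/-! ### Halfspaces relative to the basepoint. -/

section basepoint

variable {x₀ : V}

theorem mem_inward_iff_of_ne {x y : V} (h : X.graph.Adj x y) {k : X.Hyperplane}
    (hk : X.dual h ≠ k) : x ∈ X.inward x₀ k ↔ y ∈ X.inward x₀ k := by
  have : (X.graph.deleteEdges (X.edgesOf k)).Adj x y := by
    rw [deleteEdges_adj, mem_edgesOf h]
    exact ⟨h, hk⟩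
  exact ⟨fun hx => hx.trans this.reachable, fun hy => hy.trans this.symm.reachable⟩

theorem base_mem_inward (k : X.Hyperplane) : x₀ ∈ X.inward x₀ k := Reachable.refl _

/-- A geodesic from `u` to `x` stays among the vertices nearer to `x` than to `y`, whereas an edge
parallel to `h` has its ends on different sides. -/
theorem reachable_of_dist_lt (hX : X.IsCAT0) {x y : V} (h : X.graph.Adj x y) (n : ℕ) : ∀ u,
    X.graph.dist x u = n → X.graph.dist x u < X.graph.dist y u →
      (X.graph.deleteEdges (X.edgesOf (X.dual h))).Reachable x u := by
  have hc : ∀ u v, X.graph.dist u v = X.graph.dist v u := fun _ _ => dist_comm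
  induction n with
  | zero =>
    intro u hn _
    obtain rfl := (hX.1.1.dist_eq_zero_iff).1 hn
    exact Reachable.refl _
  | succ n ih =>
    intro u hn h1
    have hux : u ≠ x := by
      rintro rfl
      rw [SimpleGraph.dist_self] at hn
      omega
    obtain ⟨v, hv, hd⟩ := exists_adj_dist_lt hX hux
    have h2 := dist_adj hX h u
    have h3 := dist_adj hX h v
    have h4 := dist_adj hX hv x
    have h5 := dist_adj hX hv y
    rw [hc _ x, hc _ x] at h4 hd
    rw [hc _ y, hc _ y] at h5
    have h6 := ih v (by omega) (by omega)
    refine h6.trans (Adj.reachable ?_)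
    rw [deleteEdges_adj, mem_edgesOf hv.symm]
    refine ⟨hv.symm, fun e => ?_⟩
    rcases dist_lt_of_dual_eq hX e with h7 | h7
    · have h8 := (h7 u).2 h1
      rw [SimpleGraph.dist_self] at h8
      omega
    · have h8 := (h7 v).1
      rw [SimpleGraph.dist_self] at h8
      have := dist_adj hX hv v
      rw [SimpleGraph.dist_self] at this
      omega

/-- This identifies the halfspace defined by deleting edges with the one defined by distances, on
which the quadrangle condition can act. -/
theorem inward_dual (hX : X.IsCAT0) {x y : V} (h : X.graph.Adj x y)
    (hd : X.graph.dist x x₀ < X.graph.dist y x₀) :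
    X.inward x₀ (X.dual h) = {u | X.graph.dist x u < X.graph.dist y u} := by
  ext u
  constructor
  · rintro ⟨p⟩
    suffices ∀ {a b : V} (p : (X.graph.deleteEdges (X.edgesOf (X.dual h))).Walk a b),
        X.graph.dist x a < X.graph.dist y a → X.graph.dist x b < X.graph.dist y b from this p hd
    intro a b p
    induction p with
    | nil => exact id
    | cons e p ih =>
      intro ha
      apply ih
      rw [deleteEdges_adj] at e
      by_contra hb
      rw [dist_lt_or hX h] at hb
      apply e.2
      rw [mem_edgesOf e.1]
      exact (dual_eq_of_dist_lt hX h _ e.1 rfl ha hb).symm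
  · intro hu
    exact (reachable_of_dist_lt hX h _ _ rfl hd).symm.trans (reachable_of_dist_lt hX h _ _ rfl hu)

theorem outward_dual (hX : X.IsCAT0) {x y : V} (h : X.graph.Adj x y)
    (hd : X.graph.dist x x₀ < X.graph.dist y x₀) :
    X.outward x₀ (X.dual h) = {u | X.graph.dist y u < X.graph.dist x u} := by
  ext u
  rw [outward, inward_dual hX h hd]
  exact dist_lt_or hX h u

theorem mem_inward_dual (hX : X.IsCAT0) {x y : V} (h : X.graph.Adj x y)
    (hd : X.graph.dist y x₀ < X.graph.dist x x₀) : y ∈ X.inward x₀ (X.dual h) := by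
  rw [← dual_symm, inward_dual hX h.symm hd]
  have : X.graph.dist y y = 0 := SimpleGraph.dist_self
  have := dist_adj hX h y
  exact show X.graph.dist y y < X.graph.dist x y by omega

theorem mem_outward_dual (hX : X.IsCAT0) {x y : V} (h : X.graph.Adj x y)
    (hd : X.graph.dist y x₀ < X.graph.dist x x₀) : x ∈ X.outward x₀ (X.dual h) := by
  rw [← dual_symm, outward_dual hX h.symm hd]
  have : X.graph.dist x x = 0 := SimpleGraph.dist_self
  have := dist_adj hX h x
  exact show X.graph.dist x x < X.graph.dist y x by omega

theorem exists_dual (hX : X.IsCAT0) (x₀ : V) (k : X.Hyperplane) :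
    ∃ (x y : V) (h : X.graph.Adj x y), X.graph.dist y x₀ < X.graph.dist x x₀ ∧ X.dual h = k := by
  obtain ⟨⟨⟨x, y⟩, h⟩, rfl⟩ := Quot.exists_rep k
  have h' : X.graph.Adj x y := h
  by_cases hd : X.graph.dist x x₀ < X.graph.dist y x₀
  · exact ⟨y, x, h'.symm, hd, dual_symm h'⟩
  · exact ⟨x, y, h', (dist_lt_or hX h' _).1 hd, rfl⟩

/-- An edge dual to `k` joins the two sides of `k`, but has both ends on the same side of any other
hyperplane. -/
theorem outward_injective (hX : X.IsCAT0) : Function.Injective (X.outward x₀) := by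
  intro j k hjk
  obtain ⟨x, y, h, hd, rfl⟩ := exists_dual hX x₀ k
  by_contra hne
  have hjk' := compl_injective hjk
  have h1 := mem_inward_iff_of_ne (x₀ := x₀) h (Ne.symm hne)
  rw [hjk'] at h1
  exact mem_outward_dual hX h hd (h1.2 (mem_inward_dual hX h hd))

theorem finite_separating (x₀ : V) {x y : V} (p : X.graph.Walk x y) :
    {k | ¬ (x ∈ X.inward x₀ k ↔ y ∈ X.inward x₀ k)}.Finite := by
  induction p with
  | nil => simp
  | cons h p ih =>
    refine (ih.insert (X.dual h)).subset fun k hk => ?_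
    by_cases hk' : X.dual h = k
    · exact .inl hk'.symm
    · right
      rwa [Set.mem_ofPred_eq, mem_inward_iff_of_ne h hk'] at hk

theorem finite_outward (hX : X.IsCAT0) (x₀ v : V) : {k | v ∈ X.outward x₀ k}.Finite := by
  obtain ⟨p⟩ := hX.1.1.preconnected x₀ v
  exact (finite_separating x₀ p).subset fun k hk h => hk (h.1 (base_mem_inward k))

theorem nonempty_outward (hX : X.IsCAT0) (k : X.Hyperplane) : (X.outward x₀ k).Nonempty := by
  obtain ⟨x, y, h, hd, rfl⟩ := exists_dual hX x₀ k
  exact ⟨x, mem_outward_dual hX h hd⟩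

theorem finite_below (hX : X.IsCAT0) (x₀ : V) (h : X.Hyperplane) : {k | X.Below x₀ k h}.Finite := by
  obtain ⟨v, hv⟩ := nonempty_outward (x₀ := x₀) hX h
  exact (finite_outward hX x₀ v).subset fun k hk => hk.1 hv

theorem Below.trans {h j k : X.Hyperplane} (h1 : X.Below x₀ h j) (h2 : X.Below x₀ j k) :
    X.Below x₀ h k := lt_trans (α := Set V) h2 h1

theorem Below.irrefl (h : X.Hyperplane) : ¬ X.Below x₀ h h := fun e => ssubset_irrefl _ e

theorem Cross.symm {h k : X.Hyperplane} (hc : X.Cross x₀ h k) : X.Cross x₀ k h := by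
  obtain ⟨h1, h2, h3, h4⟩ := hc
  rw [Set.inter_comm] at h1 h2 h3 h4
  exact ⟨h1, h3, h2, h4⟩

theorem Cross.not_below {h k : X.Hyperplane} (hc : X.Cross x₀ h k) : ¬ X.Below x₀ h k := by
  intro hb
  obtain ⟨v, h1, h2⟩ := hc.2.1
  exact hb.1 h2 h1

theorem below_of_subset (hX : X.IsCAT0) {h k : X.Hyperplane} (hne : h ≠ k)
    (hs : X.outward x₀ k ⊆ X.outward x₀ h) : X.Below x₀ h k :=
  hs.ssubset_of_ne fun e => hne (outward_injective hX e).symm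

/-- Two hyperplanes with a common vertex in their outward halfspaces cross or are comparable. -/
theorem cross_or_below (hX : X.IsCAT0) {h k : X.Hyperplane} (hne : h ≠ k) {v : V}
    (hh : v ∈ X.outward x₀ h) (hk : v ∈ X.outward x₀ k) :
    X.Cross x₀ h k ∨ X.Below x₀ h k ∨ X.Below x₀ k h := by
  by_cases h1 : (X.inward x₀ h ∩ X.outward x₀ k).Nonempty
  · by_cases h2 : (X.outward x₀ h ∩ X.inward x₀ k).Nonempty
    · exact .inl ⟨⟨x₀, base_mem_inward h, base_mem_inward k⟩, h1, h2, v, hh, hk⟩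
    · refine .inr (.inr (below_of_subset hX hne.symm fun w hw => ?_))
      by_contra hw'
      exact h2 ⟨w, hw, not_not.1 hw'⟩
  · refine .inr (.inl (below_of_subset hX hne fun w hw => ?_))
    intro hw'
    exact h1 ⟨w, hw', hw⟩

/-- A hyperplane that separates `v` from the basepoint is dual to an inward edge at `v`, or
below such a hyperplane. -/
theorem exists_dual_above (hX : X.IsCAT0) {k : X.Hyperplane} (n : ℕ) : ∀ {v : V},
    X.graph.dist v x₀ = n → v ∈ X.outward x₀ k → ∃ (w : V) (h : X.graph.Adj v w),
      X.graph.dist w x₀ < X.graph.dist v x₀ ∧ (X.dual h = k ∨ X.Below x₀ k (X.dual h)) := by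
  induction n using Nat.strong_induction_on with
  | _ n ih =>
  intro v hn hv
  have hv0 : v ≠ x₀ := by
    rintro rfl
    exact hv (base_mem_inward k)
  obtain ⟨w, h, hd⟩ := exists_adj_dist_lt hX hv0
  by_cases hk : X.dual h = k
  · exact ⟨w, h, hd, .inl hk⟩
  have hw : w ∈ X.outward x₀ k := fun hw => hv ((mem_inward_iff_of_ne h hk).2 hw)
  obtain ⟨w', h', hd', hk'⟩ := ih _ (hn ▸ hd) rfl hw
  -- A vertex `u` beyond `X.dual h` but not beyond `X.dual h'` is nearer to `v` and to `w'` than to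
  -- `w`, so a square carries the edge from `w` to `w'` over to an inward edge at `v`. If there is
  -- no such vertex, `X.dual h'` is below `X.dual h`.
  by_cases hc : (X.outward x₀ (X.dual h) ∩ X.inward x₀ (X.dual h')).Nonempty
  · obtain ⟨u, hu, hu'⟩ := hc
    rw [← dual_symm h, outward_dual hX h.symm hd] at hu
    rw [← dual_symm h', inward_dual hX h'.symm hd'] at hu'
    have hne : v ≠ w' := by rintro rfl; omega
    obtain ⟨t, s, -⟩ := exists_square_of_dist hX h.symm h' hne hu hu'
    refine ⟨t, s.bc, s.rotate.rotate.rotate.dist_lt hX hd', ?_⟩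
    have : X.dual s.bc = X.dual h' := by
      rw [s.rotate.dual_eq]
    rwa [this]
  · have hlt : X.Below x₀ (X.dual h') (X.dual h) := by
      refine ⟨fun u hu hu' => hc ⟨u, hu, hu'⟩, fun hs => ?_⟩
      exact hs (mem_outward_dual hX h' hd') (mem_inward_dual hX h hd)
    refine ⟨w, h, hd, .inr ?_⟩
    rcases hk' with hk' | hk'
    · rwa [hk'] at hlt
    · exact hk'.trans hlt

open Classical in
/-- The hyperplanes dual to inward edges at a vertex are dual to the edges of a cube there. -/
theorem card_le_of_inward_edges (hX : X.IsCAT0) {D : ℕ} (hD : X.HasDimension D)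
    {T : Finset X.Hyperplane} {v : V}
    (hT : ∀ t ∈ T, ∃ (w : V) (h : X.graph.Adj v w), X.graph.dist w x₀ < X.graph.dist v x₀ ∧
      X.dual h = t) : T.card ≤ D := by
  have : Nonempty V := ⟨v⟩
  choose! w hw hd ht using hT
  have hinj : ∀ s ∈ T, ∀ t ∈ T, w s = w t → s = t := by
    intro s hs t ht' e
    rw [← ht s hs, ← ht t ht']
    congr 1
  obtain ⟨-, c, hc, hvc, hS⟩ := hX.2 v (T.image w) (by
    intro a ha b hb
    obtain ⟨s, hs, rfl⟩ := Finset.mem_image.1 ha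
    obtain ⟨t, ht', rfl⟩ := Finset.mem_image.1 hb
    refine ⟨by simp [hw s hs, hw t ht'], ?_⟩
    by_cases hst : w s = w t
    · rw [hst]
      exact ⟨_, (hw t ht').2, by simp, by simp⟩
    -- Any two inward edges at `v` span a square by the quadrangle condition towards `x₀`; flagness
    -- then puts all of them in one cube.
    · obtain ⟨y, q, -⟩ := exists_square_of_dist hX (hw s hs) (hw t ht') hst (hd s hs) (hd t ht')
      refine ⟨_, q.mem, by simp, ?_⟩
      intro e
      simp
      tauto)
  obtain ⟨n, φ, hφ, rfl⟩ := X.chart c hc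
  obtain ⟨g, rfl⟩ := hvc
  have hex : ∀ t ∈ T, ∃ i, w t = φ (flipAt i g) := fun t ht' =>
    hφ.exists_flip (hS (by simpa using ⟨t, ht', rfl⟩)) (hw t ht')
  rcases T.eq_empty_or_nonempty with rfl | ⟨t₀, ht₀⟩
  · simp
  have : Nonempty (Fin n) := ⟨(hex t₀ ht₀).choose⟩
  choose! i hi using hex
  have h1 : T.card ≤ Fintype.card (Fin n) := by
    refine Finset.card_le_card_of_injOn i (fun _ _ => Finset.mem_univ _) fun s hs t ht' e => ?_
    exact hinj s hs t ht' (by rw [hi s hs, hi t ht', e])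
  rw [Fintype.card_fin] at h1
  exact h1.trans (hD.2 ⟨_, hc, φ, hφ, rfl⟩)

/-- The number of pairwise crossing hyperplanes that separate a vertex from the basepoint is at
most the dimension. -/
theorem card_le_of_pairwise_cross (hX : X.IsCAT0) {D : ℕ} (hD : X.HasDimension D)
    {T : Finset X.Hyperplane} (hT : (T : Set X.Hyperplane).Pairwise (X.Cross x₀)) (n : ℕ) :
    ∀ {v : V}, X.graph.dist v x₀ = n → (∀ t ∈ T, v ∈ X.outward x₀ t) → T.card ≤ D := by
  induction n using Nat.strong_induction_on with
  | _ n ih =>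
  intro v hn hv
  by_cases hall : ∀ t ∈ T, ∃ (w : V) (h : X.graph.Adj v w),
      X.graph.dist w x₀ < X.graph.dist v x₀ ∧ X.dual h = t
  · exact card_le_of_inward_edges hX hD hall
  · push Not at hall
    obtain ⟨k, hk, hall⟩ := hall
    obtain ⟨w, h, hd, hkh⟩ := exists_dual_above hX _ rfl (hv k hk)
    have hkh := hkh.resolve_left (hall w h hd)
    -- The edge `h` can be crossed without leaving any `t⁺`: its hyperplane lies above `k ∈ T`, so
    -- it does not cross `k` and is not in `T`.
    refine ih _ (hn ▸ hd) rfl fun t ht hw => hv t ht ((mem_inward_iff_of_ne h ?_).2 hw)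
    rintro rfl
    have hne : k ≠ X.dual h := by
      intro e
      rw [← e] at hkh
      exact Below.irrefl k hkh
    exact (hT hk ht hne).not_below hkh

end basepoint

end CubeComplex

namespace CubeComplex

variable {V : Type u} {X : CubeComplex V} {x₀ : V}

open SimpleGraph

/-! ### The order on hyperplanes -/

/-- The number of hyperplanes below a hyperplane. -/
noncomputable def numBelow (X : CubeComplex V) (x₀ : V) (h : X.Hyperplane) : ℕ :=
  {k | X.Below x₀ k h}.ncard

theorem numBelow_lt (hX : X.IsCAT0) {k h : X.Hyperplane} (hk : X.Below x₀ k h) :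
    X.numBelow x₀ k < X.numBelow x₀ h :=
  Set.ncard_lt_ncard ⟨fun _ hj => hj.trans hk, fun hs => Below.irrefl k (hs hk)⟩
    (finite_below hX x₀ h)

theorem wellFounded_below (hX : X.IsCAT0) (x₀ : V) : WellFounded (X.Below x₀) :=
  Subrelation.wf (fun hk => numBelow_lt hX hk) (measure (X.numBelow x₀)).wf

/-- A finite set of hyperplanes that are pairwise comparable. -/
def IsBelowChain (X : CubeComplex V) (x₀ : V) (C : Finset X.Hyperplane) : Prop :=
  ∀ a ∈ C, ∀ b ∈ C, a ≠ b → X.Below x₀ a b ∨ X.Below x₀ b a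

theorem IsBelowChain.subset {C C' : Finset X.Hyperplane} (h : X.IsBelowChain x₀ C) (hs : C' ⊆ C) :
    X.IsBelowChain x₀ C' :=
  fun a ha b hb => h a (hs ha) b (hs hb)

theorem IsBelowChain.exists_least (hX : X.IsCAT0) {C : Finset X.Hyperplane}
    (h : X.IsBelowChain x₀ C) (hC : C.Nonempty) : ∃ a ∈ C, ∀ c ∈ C, c ≠ a → X.Below x₀ a c := by
  obtain ⟨a, ha, hmin⟩ := C.exists_min_image (X.numBelow x₀) hC
  refine ⟨a, ha, fun c hc hca => (h c hc a ha hca).resolve_left fun hb => ?_⟩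
  exact (hmin c hc).not_gt (numBelow_lt hX hb)

theorem IsBelowChain.exists_greatest (hX : X.IsCAT0) {C : Finset X.Hyperplane}
    (h : X.IsBelowChain x₀ C) (hC : C.Nonempty) : ∃ a ∈ C, ∀ c ∈ C, c ≠ a → X.Below x₀ c a := by
  obtain ⟨a, ha, hmax⟩ := C.exists_max_image (X.numBelow x₀) hC
  refine ⟨a, ha, fun c hc hca => (h c hc a ha hca).resolve_right fun hb => ?_⟩
  exact (hmax c hc).not_gt (numBelow_lt hX hb)

open Classical in
/-- Mirsky's theorem: a bound on chains and antichains bounds the cardinality. -/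
theorem card_le_of_chains (hX : X.IsCAT0) {D : ℕ} (N : ℕ) : ∀ {S : Finset X.Hyperplane},
    (∀ C ⊆ S, X.IsBelowChain x₀ C → C.card ≤ N) →
    (∀ T ⊆ S, (∀ a ∈ T, ∀ b ∈ T, ¬ X.Below x₀ a b) → T.card ≤ D) → S.card ≤ N * D := by
  induction N with
  | zero =>
    intro S hC _
    rcases S.eq_empty_or_nonempty with rfl | ⟨s, hs⟩
    · simp
    · have := hC {s} (by simpa using hs) (by intro a ha b hb; simp_all)
      simp at this
  | succ N ih =>
    intro S hC hT
    have h1 : (S.filter fun s => ∀ g ∈ S, ¬ X.Below x₀ g s).card ≤ D :=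
      hT _ (Finset.filter_subset _ _) fun a ha b hb =>
        (Finset.mem_filter.1 hb).2 a (Finset.mem_filter.1 ha).1
    have h2 : (S.filter fun s => ¬ ∀ g ∈ S, ¬ X.Below x₀ g s).card ≤ N * D := by
      -- A chain without minimal elements of `S` can be extended downwards inside `S`, so it has at
      -- most `N` elements.
      refine ih (fun C hCs hc => ?_) fun T hTs => hT T (hTs.trans (Finset.filter_subset _ _))
      rcases C.eq_empty_or_nonempty with rfl | hne
      · simp
      obtain ⟨a, ha, hmin⟩ := hc.exists_least hX hne
      have := (Finset.mem_filter.1 (hCs ha)).2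
      push Not at this
      obtain ⟨g, hg, hga⟩ := this
      have hgC : ∀ c ∈ C, X.Below x₀ g c := fun c hcC => by
        by_cases hca : c = a
        · rwa [hca]
        · exact hga.trans (hmin c hcC hca)
      have hnot : g ∉ C := fun h => Below.irrefl g (hgC g h)
      have := hC (insert g C) (Finset.insert_subset hg (hCs.trans (Finset.filter_subset _ _))) (by
        intro b hb₀ c hc₀ hbc
        rcases Finset.mem_insert.1 hb₀ with rfl | hb <;>
          rcases Finset.mem_insert.1 hc₀ with rfl | hc'
        · exact (hbc rfl).elim
        · exact .inl (hgC c hc')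
        · exact .inr (hgC b hb)
        · exact hc b hb c hc' hbc)
      rw [Finset.card_insert_of_notMem hnot] at this
      omega
    have := Finset.card_filter_add_card_filter_not (s := S) fun s => ∀ g ∈ S, ¬ X.Below x₀ g s
    rw [add_mul, one_mul]
    omega

/-! ### Ranks -/

theorem InCorner.of_below {d : ℕ} {S : Set X.Hyperplane} {k h : X.Hyperplane}
    (hk : X.InCorner x₀ d S k) (hkh : X.Below x₀ k h) : X.InCorner x₀ d S h := by
  obtain ⟨T, h1, h2, h3, h4⟩ := hk
  exact ⟨T, h1, h2, h3, fun j hj => (h4 j hj).trans hkh⟩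

theorem InCorner.mono {d e : ℕ} (hde : d ≤ e) {S : Set X.Hyperplane} {h : X.Hyperplane}
    (hh : X.InCorner x₀ e S h) : X.InCorner x₀ d S h := by
  obtain ⟨T, rfl, h2, h3, h4⟩ := hh
  obtain ⟨T', hT', rfl⟩ := Finset.exists_subset_card_eq hde
  exact ⟨T', rfl, fun t ht => h2 (hT' ht), h3.mono fun t ht => hT' ht, fun k hk => h4 k (hT' hk)⟩

theorem InCorner.mono_set {d : ℕ} {S S' : Set X.Hyperplane} (hS : S ⊆ S') {h : X.Hyperplane}
    (hh : X.InCorner x₀ d S h) : X.InCorner x₀ d S' h := by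
  obtain ⟨T, h1, h2, h3, h4⟩ := hh
  exact ⟨T, h1, h2.trans hS, h3, h4⟩

theorem rankGE_antitone (d : ℕ) (S : Set X.Hyperplane) : Antitone (X.rankGE x₀ d S) :=
  antitone_nat_of_succ_le fun _ _ h => h.1

theorem mem_rankGE_of_below {d : ℕ} {S : Set X.Hyperplane} {k h : X.Hyperplane} (hh : h ∈ S)
    (hkh : X.Below x₀ k h) {n : ℕ} (hk : k ∈ X.rankGE x₀ d S n) : h ∈ X.rankGE x₀ d S n := by
  induction n with
  | zero => exact hh
  | succ n ih => exact ⟨ih hk.1, hk.2.of_below hkh⟩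

theorem le_numBelow_of_mem_rankGE (hX : X.IsCAT0) {d : ℕ} (hd : 1 ≤ d) {S : Set X.Hyperplane}
    (n : ℕ) : ∀ {h : X.Hyperplane}, h ∈ X.rankGE x₀ d S n → n ≤ X.numBelow x₀ h := by
  induction n with
  | zero => exact fun _ => Nat.zero_le _
  | succ n ih =>
    rintro h ⟨-, T, hT, hTS, -, hTh⟩
    obtain ⟨k, hk⟩ := Finset.card_pos.1 (hT ▸ hd : 0 < T.card)
    exact (ih (hTS hk)).trans_lt (numBelow_lt hX (hTh k hk))

/-- The infimum defining `rank` is over a nonempty set, so its default value 0 plays no role: each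
hyperplane leaves the filtration, at the latest after as many levels as there are hyperplanes below
it. -/
theorem mem_rankGE_iff (hX : X.IsCAT0) {d : ℕ} (hd : 1 ≤ d) {S : Set X.Hyperplane}
    {h : X.Hyperplane} (hh : h ∈ S) {n : ℕ} :
    h ∈ X.rankGE x₀ d S n ↔ n ≤ X.rank x₀ d S h := by
  classical
  have hex : ∃ n, h ∉ X.rankGE x₀ d S n :=
    ⟨_, fun hm => (le_numBelow_of_mem_rankGE hX hd (X.numBelow x₀ h + 1) hm).not_gt
      (Nat.lt_succ_self _)⟩
  have hne : {n | h ∈ X.rankGE x₀ d S n ∧ h ∉ X.rankGE x₀ d S (n + 1)}.Nonempty := by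
    rcases hm : Nat.find hex with _ | m
    · exact ((hm ▸ Nat.find_spec hex) hh).elim
    · exact ⟨m, not_not.1 (Nat.find_min hex (m := m) (by omega)), hm ▸ Nat.find_spec hex⟩
  obtain ⟨h1, h2⟩ : h ∈ X.rankGE x₀ d S (X.rank x₀ d S h) ∧
    h ∉ X.rankGE x₀ d S (X.rank x₀ d S h + 1) := Nat.sInf_mem hne
  refine ⟨fun hn => ?_, fun hn => rankGE_antitone d S hn h1⟩
  by_contra hlt
  exact h2 (rankGE_antitone d S (not_le.1 hlt) hn)

theorem rank_le_of_below (hX : X.IsCAT0) {d : ℕ} (hd : 1 ≤ d) {S : Set X.Hyperplane}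
    {k h : X.Hyperplane} (hk : k ∈ S) (hh : h ∈ S) (hkh : X.Below x₀ k h) :
    X.rank x₀ d S k ≤ X.rank x₀ d S h :=
  (mem_rankGE_iff hX hd hh).1 (mem_rankGE_of_below hh hkh ((mem_rankGE_iff hX hd hk).2 le_rfl))

/-! ### Rank classes and the lexicographic order. -/

section rankVector

variable {D : ℕ}

theorem mem_rankClass_self (h : X.Hyperplane) (i : ℕ) : h ∈ X.rankClass x₀ D h i := by
  induction i with
  | zero => trivial
  | succ i ih => exact ⟨ih, rfl⟩

theorem rankClass_eq {h k : X.Hyperplane} {i : ℕ} (hk : k ∈ X.rankClass x₀ D h i) :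
    X.rankClass x₀ D k i = X.rankClass x₀ D h i := by
  induction i with
  | zero => rfl
  | succ i ih =>
    ext j
    simp only [rankClass, ih hk.1, hk.2]

theorem mem_rankClass_iff {h k : X.Hyperplane} {i : ℕ} :
    k ∈ X.rankClass x₀ D h i ↔ ∀ j < i, X.rank x₀ (D - j) (X.rankClass x₀ D k j) k =
      X.rank x₀ (D - j) (X.rankClass x₀ D h j) h := by
  induction i with
  | zero => simp [rankClass]
  | succ i ih =>
    constructor
    · intro hk j hj
      rcases Nat.lt_succ_iff_lt_or_eq.1 hj with hj | rfl
      · exact ih.1 hk.1 j hj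
      · rw [rankClass_eq hk.1]
        exact hk.2
    · intro hk
      have h1 := ih.2 fun j hj => hk j (hj.trans (Nat.lt_succ_self i))
      refine ⟨h1, ?_⟩
      have h2 := hk i (Nat.lt_succ_self i)
      rwa [rankClass_eq h1] at h2

theorem le_of_toLex_le {n : ℕ} {a b : Fin n → ℕ} (hab : toLex a ≤ toLex b) {i : Fin n}
    (h : ∀ j < i, a j = b j) : a i ≤ b i := by
  by_contra hlt
  exact (not_lt.2 hab) ⟨i, fun j hj => (h j hj).symm, not_le.1 hlt⟩

/-- Up to the first entry where the vectors differ, both hyperplanes lie in the same class, and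
within a class the rank is monotone. -/
theorem rankVector_le_of_below (hX : X.IsCAT0) {k h : X.Hyperplane} (hkh : X.Below x₀ k h) :
    X.rankVector x₀ D k ≤ X.rankVector x₀ D h := by
  by_contra hlt
  obtain ⟨i, h1, h2⟩ := not_le.1 hlt
  have hh : h ∈ X.rankClass x₀ D k i := mem_rankClass_iff.2 fun j hj =>
    h1 ⟨j, hj.trans i.2⟩ hj
  have h2 : X.rank x₀ (D - i) (X.rankClass x₀ D h i) h <
    X.rank x₀ (D - i) (X.rankClass x₀ D k i) k := h2
  rw [rankClass_eq hh] at h2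
  exact h2.not_ge (rank_le_of_below hX (by omega) (mem_rankClass_self k i) hh hkh)

/-- The classes of hyperplanes are convex with respect to the order of the rank-vectors. -/
theorem mem_rankClass_of_between {a b k h : X.Hyperplane} {i : ℕ} (hi : i ≤ D - 1)
    (ha : a ∈ X.rankClass x₀ D h i) (hb : b ∈ X.rankClass x₀ D h i)
    (hak : X.rankVector x₀ D a ≤ X.rankVector x₀ D k)
    (hkb : X.rankVector x₀ D k ≤ X.rankVector x₀ D b) : k ∈ X.rankClass x₀ D h i := by
  have ha' := mem_rankClass_iff.1 ha
  have hb' := mem_rankClass_iff.1 hb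
  rw [mem_rankClass_iff]
  intro j
  induction j using Nat.strong_induction_on with
  | _ j ih =>
  intro hj
  refine le_antisymm ?_ ?_
  · rw [← hb' j hj]
    exact le_of_toLex_le (i := ⟨j, by omega⟩) hkb fun l hl =>
      (ih l hl (lt_trans hl hj)).trans (hb' l (lt_trans hl hj)).symm
  · rw [← ha' j hj]
    exact le_of_toLex_le (i := ⟨j, by omega⟩) hak fun l hl =>
      (ha' l (lt_trans hl hj)).trans (ih l hl (lt_trans hl hj)).symm

theorem rank_le_of_rankVector_le {a k h : X.Hyperplane} {i : ℕ} (hi : i < D - 1)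
    (ha : a ∈ X.rankClass x₀ D h i) (hk : k ∈ X.rankClass x₀ D h i)
    (hak : X.rankVector x₀ D a ≤ X.rankVector x₀ D k) :
    X.rank x₀ (D - i) (X.rankClass x₀ D h i) a ≤ X.rank x₀ (D - i) (X.rankClass x₀ D h i) k := by
  have := le_of_toLex_le (i := ⟨i, hi⟩) hak fun l hl =>
    (mem_rankClass_iff.1 ha l hl).trans (mem_rankClass_iff.1 hk l hl).symm
  simp only [rankClass_eq ha, rankClass_eq hk] at this
  exact this

end rankVector

end CubeComplex

namespace CubeComplex

variable {V : Type u} {X : CubeComplex V} {x₀ : V} {D : ℕ}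

open SimpleGraph

/-! ### Chains in sets of hyperplanes with escaping predecessors -/

/-- Every hyperplane of `S` that is not minimal in `S` is above some `k` which crosses all smaller
hyperplanes of `S` and whose rank-vector dominates theirs. -/
def HasEscapes (X : CubeComplex V) (x₀ : V) (D : ℕ) (S : Set X.Hyperplane) : Prop :=
  ∀ h ∈ S, (∃ g ∈ S, X.Below x₀ g h) → ∃ k, X.Below x₀ k h ∧ ∀ g ∈ S, X.Below x₀ g h →
    X.Cross x₀ k g ∧ X.rankVector x₀ D g ≤ X.rankVector x₀ D k

open Classical in
-- If `a` is below `b` in the chain, the escape `k` of `b` has its rank-vector between theirs, so it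
-- lies in the class. Then `k` and `a` bound a 2-corner around `b`.
theorem HasEscapes.card_le_one (hX : X.IsCAT0) {S : Set X.Hyperplane} (hS : X.HasEscapes x₀ D S)
    {C : Finset X.Hyperplane} (hCS : (C : Set X.Hyperplane) ⊆ S) (hC : X.IsBelowChain x₀ C)
    {h : X.Hyperplane} {i : ℕ} (hi : i ≤ D - 1)
    (hCA : (C : Set X.Hyperplane) ⊆ X.rankClass x₀ D h i)
    (hA : ∀ k ∈ X.rankClass x₀ D h i, ¬ X.InCorner x₀ 2 (X.rankClass x₀ D h i) k) :
    C.card ≤ 1 := by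
  rw [Finset.card_le_one]
  have key : ∀ a ∈ C, ∀ b ∈ C, ¬ X.Below x₀ a b := by
    intro a ha b hb hab
    obtain ⟨k, hk, hk'⟩ := hS b (hCS hb) ⟨a, hCS ha, hab⟩
    obtain ⟨h1, h2⟩ := hk' a (hCS ha) hab
    have hkA := mem_rankClass_of_between hi (hCA ha) (hCA hb) h2 (rankVector_le_of_below hX hk)
    have hka : k ≠ a := by
      rintro rfl
      obtain ⟨v, hv, hv'⟩ := h1.2.1
      exact hv' hv
    refine hA b (hCA hb) ⟨{k, a}, Finset.card_pair hka, ?_, ?_, ?_⟩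
    · intro j hj
      rcases Finset.mem_insert.1 hj with rfl | hj
      · exact hkA
      · rw [Finset.mem_singleton.1 hj]
        exact hCA ha
    · rw [Finset.coe_pair, Set.pairwise_pair]
      exact fun _ => ⟨h1, h1.symm⟩
    · simp [hk, hab]
  intro a ha b hb
  by_contra hne
  rcases hC a ha b hb hne with hab | hab
  · exact key a ha b hb hab
  · exact key b hb a ha hab

open Classical in
theorem HasEscapes.card_image_rank_le (hX : X.IsCAT0) {S : Set X.Hyperplane}
    (hS : X.HasEscapes x₀ D S) {C : Finset X.Hyperplane} (hCS : (C : Set X.Hyperplane) ⊆ S)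
    (hC : X.IsBelowChain x₀ C) {h : X.Hyperplane} {i : ℕ} (hi : i < D - 1)
    (hCA : (C : Set X.Hyperplane) ⊆ X.rankClass x₀ D h i)
    (hA : ∀ k ∈ X.rankClass x₀ D h i, ¬ X.InCorner x₀ (D - i + 1) (X.rankClass x₀ D h i) k) :
    (C.image (X.rank x₀ (D - i) (X.rankClass x₀ D h i))).card ≤ 3 := by
  set A := X.rankClass x₀ D h i
  set n := X.rank x₀ (D - i) A
  have hd : 1 ≤ D - i := by omega
  rcases C.eq_empty_or_nonempty with rfl | hne
  · simp
  obtain ⟨a, ha, hleast⟩ := hC.exists_least hX hne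
  obtain ⟨b, hb, hgreatest⟩ := hC.exists_greatest hX hne
  -- The greatest element needs a value of its own: the argument bounding `n g` applies only to `g`
  -- strictly below `b`, as it uses the escape of `b`.
  suffices hsub : C.image n ⊆ {n a, n a + 1, n b} from
    (Finset.card_le_card hsub).trans Finset.card_le_three
  intro m hm
  obtain ⟨g, hg, rfl⟩ := Finset.mem_image.1 hm
  by_cases hga : g = a
  · simp [hga]
  by_cases hgb : g = b
  · simp [hgb]
  have hag := hleast g hg hga
  have hgb := hgreatest g hg hgb
  have hle : n a ≤ n g := rank_le_of_below hX hd (hCA ha) (hCA hg) hag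
  suffices hlt : n g < n a + 2 by
    simp only [Finset.mem_insert, Finset.mem_singleton]
    omega
  by_contra hge
  obtain ⟨k, hk, hk'⟩ := hS b (hCS hb) ⟨g, hCS hg, hgb⟩
  have h2 := (hk' g (hCS hg) hgb).2
  have hkA : k ∈ A := mem_rankClass_of_between hi.le (hCA hg) (hCA hb) h2
    (rankVector_le_of_below hX hk)
  have hnk : n g ≤ n k := rank_le_of_rankVector_le hi (hCA hg) hkA h2
  have hcross := (hk' a (hCS ha) (hag.trans hgb)).1
  obtain ⟨-, T, hTc, hTA, hT, hTk⟩ : k ∈ X.rankGE x₀ (D - i) A (n a + 1 + 1) :=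
    (mem_rankGE_iff hX hd hkA).2 (show n a + 1 + 1 ≤ n k by omega)
  have hTA' : ∀ t ∈ T, t ∈ A ∧ n a + 1 ≤ n t := fun t ht => by
    have h0 : t ∈ A := rankGE_antitone (D - i) A (Nat.zero_le _) (hTA ht)
    exact ⟨h0, (mem_rankGE_iff hX hd h0).1 (hTA ht)⟩
  have haT : a ∉ T := fun h => by
    have := (hTA' a h).2
    omega
  obtain ⟨v, hv⟩ := nonempty_outward (x₀ := x₀) hX b
  -- If `a` were below `t` it would be below `k`, which it crosses; if `t` were below `a`, the rank
  -- of `t` could not exceed that of `a`.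
  have hTa : ∀ t ∈ T, X.Cross x₀ a t := by
    intro t ht
    have hta : a ≠ t := by rintro rfl; exact haT ht
    rcases cross_or_below hX hta ((hag.trans hgb).1 hv) (((hTk t ht).trans hk).1 hv)
      with h1 | h1 | h1
    · exact h1
    · exact (hcross.symm.not_below (h1.trans (hTk t ht))).elim
    · have : n t ≤ n a := rank_le_of_below hX hd (hTA' t ht).1 (hCA ha) h1
      have := (hTA' t ht).2
      omega
  refine hA b (hCA hb) ⟨insert a T, by rw [Finset.card_insert_of_notMem haT, hTc], ?_, ?_, ?_⟩
  · intro t ht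
    rcases Finset.mem_insert.1 ht with rfl | ht
    · exact hCA ha
    · exact (hTA' t ht).1
  · rw [Finset.coe_insert]
    exact hT.insert fun t ht _ => ⟨hTa t ht, (hTa t ht).symm⟩
  · intro t ht
    rcases Finset.mem_insert.1 ht with rfl | ht
    · exact hag.trans hgb
    · exact (hTk t ht).trans hk

/-- A class of hyperplanes of equal `d`-rank contains no `d`-corner bounded by the class. -/
theorem not_inCorner_rankClass_succ (hX : X.IsCAT0) {h k : X.Hyperplane} {i : ℕ} (hi : 1 ≤ D - i)
    (hk : k ∈ X.rankClass x₀ D h (i + 1)) :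
    ¬ X.InCorner x₀ (D - i) (X.rankClass x₀ D h (i + 1)) k := by
  intro hc
  set n := X.rank x₀ (D - i) (X.rankClass x₀ D h i)
  have hsub : X.rankClass x₀ D h (i + 1) ⊆ X.rankGE x₀ (D - i) (X.rankClass x₀ D h i) (n k) := by
    intro j hj
    exact (mem_rankGE_iff hX hi hj.1).2 (show n k ≤ n j from (hk.2.trans hj.2.symm).le)
  have : k ∈ X.rankGE x₀ (D - i) (X.rankClass x₀ D h i) (n k + 1) :=
    ⟨(mem_rankGE_iff hX hi hk.1).2 le_rfl, hc.mono_set hsub⟩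
  exact ((mem_rankGE_iff hX hi hk.1).1 this).not_gt (Nat.lt_succ_self _)

open Classical in
-- Here `j` counts the ranks still to be fixed, in dimensions `j + 1, …, 2`. Only those of dimension
-- at most `f` can vary, which explains `min j (f - 1)`.
theorem HasEscapes.card_le_pow (hX : X.IsCAT0) {f : ℕ} (hf : X.IsFlat x₀ (f + 1))
    (hf1 : 1 ≤ f) {S : Set X.Hyperplane} (hS : X.HasEscapes x₀ D S) (j : ℕ) :
    ∀ {C : Finset X.Hyperplane} {h : X.Hyperplane} {i : ℕ}, i + (j + 1) = D →
      (C : Set X.Hyperplane) ⊆ S → X.IsBelowChain x₀ C →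
      (C : Set X.Hyperplane) ⊆ X.rankClass x₀ D h i →
      (∀ k ∈ X.rankClass x₀ D h i, ¬ X.InCorner x₀ (j + 1 + 1) (X.rankClass x₀ D h i) k) →
      C.card ≤ 3 ^ (min j (f - 1)) := by
  induction j with
  | zero =>
    intro C h i hi hCS hC hCA hA
    simpa using hS.card_le_one hX hCS hC (by omega) hCA hA
  | succ j ih =>
    intro C h i hi hCS hC hCA hA
    have hDi : D - i = j + 1 + 1 := by omega
    set n := X.rank x₀ (D - i) (X.rankClass x₀ D h i) with hn
    have hfib : ∀ m, (C.filter fun c => n c = m).card ≤ 3 ^ (min j (f - 1)) := by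
      intro m
      rcases (C.filter fun c => n c = m).eq_empty_or_nonempty with he | ⟨g, hg⟩
      · simp [he]
      have hg' := Finset.mem_filter.1 hg
      have hsub : C.filter (fun c => n c = m) ⊆ C := Finset.filter_subset _ _
      refine ih (h := g) (i := i + 1) (by omega) (fun c hc => hCS (hsub hc)) (hC.subset hsub) ?_ ?_
      · intro c hc
        have hc' := Finset.mem_filter.1 hc
        rw [rankClass, rankClass_eq (hCA hg'.1)]
        exact ⟨hCA hc'.1, hc'.2.trans hg'.2.symm⟩
      · intro k hk
        rw [← hDi]
        exact not_inCorner_rankClass_succ hX (by omega) hk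
    -- Each fibre of the rank lies in a class of the next subdivision, to which induction applies;
    -- it remains to count the values.
    have himage : C.card ≤ 3 ^ (min j (f - 1)) * (C.image n).card :=
      Finset.card_le_mul_card_image C _ fun m _ => hfib m
    rcases Nat.lt_or_ge j (f - 1) with hjf | hjf
    · have h3 := hS.card_image_rank_le hX hCS hC (by omega) hCA (by rwa [hDi])
      rw [min_eq_left (by omega)] at himage ⊢
      rw [pow_succ]
      exact himage.trans (Nat.mul_le_mul_left _ h3)
    -- Here the dimension `j + 2` of the rank exceeds `f`, so a positive rank would contradict
    -- flatness.
    · have h1 : (C.image n).card ≤ 1 := by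
        have hz : ∀ c ∈ C, n c = 0 := by
          intro c hc
          by_contra h0
          have := (mem_rankGE_iff (d := D - i) (n := 1) hX (by omega) (hCA hc)).2
            (Nat.one_le_iff_ne_zero.2 h0)
          exact hf c ((this.2.mono_set (Set.subset_univ _)).mono (by omega))
        refine (Finset.card_le_card (t := {0}) ?_).trans (by simp)
        intro m hm
        obtain ⟨c, hc, rfl⟩ := Finset.mem_image.1 hm
        simp [hz c hc]
      rw [min_eq_right hjf] at himage
      rw [min_eq_right (by omega)]
      exact himage.trans ((Nat.mul_le_mul_left _ h1).trans (by simp))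

theorem isFlat_of_hasDimension (hX : X.IsCAT0) (hD : X.HasDimension D) {d : ℕ} (hd : D < d) :
    X.IsFlat x₀ d := by
  rintro h ⟨T, rfl, -, hT, hTh⟩
  obtain ⟨v, hv⟩ := nonempty_outward (x₀ := x₀) hX h
  exact hd.not_ge (card_le_of_pairwise_cross hX hD hT _ rfl fun t ht => (hTh t ht).1 hv)

theorem flatness_spec (hX : X.IsCAT0) (hD : X.HasDimension D) :
    1 ≤ X.flatness x₀ ∧ X.IsFlat x₀ (X.flatness x₀ + 1) :=
  Nat.sInf_mem (s := {d | 1 ≤ d ∧ X.IsFlat x₀ (d + 1)})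
    ⟨max 1 D, le_max_left _ _, isFlat_of_hasDimension hX hD (by omega)⟩

theorem HasEscapes.card_le (hX : X.IsCAT0) (hD : X.HasDimension D) {S : Finset X.Hyperplane}
    (hS : X.HasEscapes x₀ D (S : Set X.Hyperplane)) {v : V} (hv : ∀ h ∈ S, v ∈ X.outward x₀ h) :
    S.card ≤ 3 ^ (X.flatness x₀ - 1) * D := by
  obtain ⟨hf1, hf⟩ := flatness_spec (x₀ := x₀) hX hD
  have hanti : ∀ T ⊆ S, (∀ a ∈ T, ∀ b ∈ T, ¬ X.Below x₀ a b) → T.card ≤ D := by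
    intro T hTS hT
    refine card_le_of_pairwise_cross hX hD (fun a ha b hb hab => ?_) _ rfl fun t ht => hv t (hTS ht)
    rcases cross_or_below hX hab (hv a (hTS ha)) (hv b (hTS hb)) with h | h | h
    · exact h
    · exact (hT a ha b hb h).elim
    · exact (hT b hb a ha h).elim
  refine card_le_of_chains hX _ (fun C hCS hC => ?_) hanti
  rcases C.eq_empty_or_nonempty with rfl | ⟨h, hh⟩
  · simp
  -- The induction starts at `j = D - 1`, a truncated subtraction; a nonempty chain rules out `D =
  -- 0`, as a singleton is an antichain.
  have hD1 : 1 ≤ D := by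
    have := hanti {h} (by simpa using hCS hh) (by
      intro a ha b hb
      rw [Finset.mem_singleton.1 ha, Finset.mem_singleton.1 hb]
      exact Below.irrefl h)
    simpa using this
  refine (hS.card_le_pow hX hf hf1 (D - 1) (h := h) (i := 0) (by omega) (fun c hc => hCS hc) hC
    (Set.subset_univ _) fun k _ => isFlat_of_hasDimension hX hD (by omega) k).trans ?_
  exact Nat.pow_le_pow_right (by norm_num) (min_le_right _ _)

/-! ### The colouring -/

theorem exists_predecessor_above (hX : X.IsCAT0) {g h : X.Hyperplane} (hgh : X.Below x₀ g h) :
    ∃ k, X.IsPredecessor x₀ k h ∧ (k = g ∨ X.Below x₀ g k) := by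
  have hfin : {k | X.Below x₀ k h ∧ (k = g ∨ X.Below x₀ g k)}.Finite :=
    (finite_below hX x₀ h).subset fun k hk => hk.1
  obtain ⟨k, ⟨hk, hgk⟩, hmax⟩ :=
    Set.exists_max_image _ (X.numBelow x₀) hfin ⟨g, hgh, .inl rfl⟩
  refine ⟨k, ⟨hk, ?_⟩, hgk⟩
  rintro ⟨j, hkj, hjh⟩
  refine (hmax j ⟨hjh, .inr ?_⟩).not_gt (numBelow_lt hX hkj)
  rcases hgk with rfl | hgk
  · exact hkj
  · exact hgk.trans hkj

theorem exists_isMaxPredecessor (hX : X.IsCAT0) {g h : X.Hyperplane} (hgh : X.Below x₀ g h) :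
    ∃ k, X.IsMaxPredecessor x₀ D k h := by
  have hfin : {k | X.IsPredecessor x₀ k h}.Finite :=
    (finite_below hX x₀ h).subset fun k hk => hk.1
  obtain ⟨j, hj, -⟩ := exists_predecessor_above hX hgh
  obtain ⟨k, hk, hmax⟩ := Set.exists_max_image _ (X.rankVector x₀ D) hfin ⟨j, hj⟩
  exact ⟨k, hk, hmax⟩

/-- A monochromatic set of hyperplanes that is convex in the order has escaping predecessors. -/
theorem IsRankColouring.hasEscapes (hX : X.IsCAT0) {c : X.Hyperplane → Fin 2}
    (hc : X.IsRankColouring x₀ D c) {S : Set X.Hyperplane} {b : Fin 2} (hb : ∀ h ∈ S, c h = b)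
    (hconv : ∀ g ∈ S, ∀ h ∈ S, ∀ k, X.Below x₀ g k → X.Below x₀ k h → k ∈ S) :
    X.HasEscapes x₀ D S := by
  rintro h hh ⟨g₀, hg₀, hg₀h⟩
  -- The recursion gives a maximal predecessor of the other colour: any one if `c h = 1`, and some
  -- one of colour 1 if `c h = 0`.
  obtain ⟨k, hk, hkS⟩ : ∃ k, X.IsMaxPredecessor x₀ D k h ∧ k ∉ S := by
    by_cases hall : ∀ k, X.IsMaxPredecessor x₀ D k h → c k = 0
    · obtain ⟨k, hk⟩ := exists_isMaxPredecessor (D := D) hX hg₀h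
      refine ⟨k, hk, fun hkS => ?_⟩
      have h1 := (hc h).1 hall
      have h2 := hall k hk
      rw [hb h hh, ← hb k hkS, h2] at h1
      exact absurd h1 (by decide)
    · have h1 := (hc h).2 hall
      push Not at hall
      obtain ⟨k, hk, hk0⟩ := hall
      refine ⟨k, hk, fun hkS => hk0 ?_⟩
      rw [hb k hkS, ← hb h hh, h1]
  refine ⟨k, hk.1.1, fun g hg hgh => ⟨?_, ?_⟩⟩
  · obtain ⟨v, hv⟩ := nonempty_outward (x₀ := x₀) hX h
    have hne : k ≠ g := by rintro rfl; exact hkS hg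
    -- Comparability is impossible: `k` below `g` contradicts that `k` is a predecessor of `h`, and
    -- `g` below `k` puts `k` in `S` by convexity.
    rcases cross_or_below hX hne (hk.1.1.1 hv) (hgh.1 hv) with h1 | h1 | h1
    · exact h1
    · exact (hk.1.2 ⟨g, h1, hgh⟩).elim
    · exact (hkS (hconv g hg h hh k h1 hk.1.1)).elim
  · obtain ⟨j, hj, hgj⟩ := exists_predecessor_above hX hgh
    refine le_trans ?_ (hk.2 j hj)
    rcases hgj with rfl | hgj
    · exact le_rfl
    · exact rankVector_le_of_below hX hgj

theorem existsUnique_isRankColouring (hX : X.IsCAT0) (x₀ : V) (D : ℕ) :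
    ∃! c : X.Hyperplane → Fin 2, X.IsRankColouring x₀ D c := by
  classical
  have wf := wellFounded_below hX x₀
  let F : ∀ h : X.Hyperplane, (∀ k, X.Below x₀ k h → Fin 2) → Fin 2 := fun h r =>
    if ∀ k, ∀ hk : X.IsMaxPredecessor x₀ D k h, r k hk.1.1 = 0 then 1 else 0
  refine ⟨wf.fix F, fun h => ⟨fun hall => ?_, fun hall => ?_⟩, fun c hc => ?_⟩
  · rw [wf.fix_eq]
    exact if_pos hall
  · rw [wf.fix_eq]
    exact if_neg hall
  · funext h
    induction h using wf.induction with
    | _ h ih =>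
    rw [wf.fix_eq]
    by_cases hall : ∀ k, X.IsMaxPredecessor x₀ D k h → c k = 0
    · rw [(hc h).1 hall]
      exact (if_pos fun k hk => (ih k hk.1.1).symm.trans (hall k hk)).symm
    · rw [(hc h).2 hall]
      exact (if_neg fun hall' => hall fun k hk => (ih k hk.1.1).trans (hall' k hk)).symm

/-- An edge path whose edges all point towards the basepoint crosses as many hyperplanes as it has
edges, each from its outward to its inward side. -/
theorem exists_finset_crossed (hX : X.IsCAT0) {x y : V} (p : X.graph.Walk x y)
    (hp : ∀ e ∈ p.darts, X.graph.dist x₀ e.snd < X.graph.dist x₀ e.fst) :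
    (∀ k, x ∈ X.inward x₀ k → y ∈ X.inward x₀ k) ∧ ∃ S : Finset X.Hyperplane,
      S.card = p.length ∧ ∀ h ∈ S, x ∈ X.outward x₀ h ∧ y ∈ X.inward x₀ h := by
  classical
  induction p with
  | nil => exact ⟨fun _ => id, ∅, rfl, by simp⟩
  | @cons x v y h p ih =>
    obtain ⟨h1, S, hS, hS'⟩ := ih fun e he => hp e (by simp [he])
    have hd : X.graph.dist v x₀ < X.graph.dist x x₀ := by
      have := hp ⟨(x, v), h⟩ (by simp)
      rwa [dist_comm (u := v), dist_comm (u := x)]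
    have hx := mem_outward_dual hX h hd
    have hv := mem_inward_dual hX h hd
    -- The rest of the path starts on the inward side of `X.dual h`, while members of `S` have `v`
    -- on their outward side; so no hyperplane is counted twice.
    have hnot : X.dual h ∉ S := fun hm => (hS' _ hm).1 hv
    refine ⟨fun k hk => h1 k ?_, insert (X.dual h) S, ?_, ?_⟩
    · by_cases hkh : X.dual h = k
      · rwa [← hkh]
      · exact (mem_inward_iff_of_ne h hkh).1 hk
    · rw [Finset.card_insert_of_notMem hnot, hS, Walk.length_cons]
    · intro k hk
      rcases Finset.mem_insert.1 hk with rfl | hk'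
      · exact ⟨hx, h1 _ hv⟩
      · have hne : X.dual h ≠ k := by rintro rfl; exact hnot hk'
        exact ⟨fun hxk => (hS' k hk').1 ((mem_inward_iff_of_ne h hne).1 hxk), (hS' k hk').2⟩

theorem exists_mem_edges_of_separated {k : X.Hyperplane} {x y : V} (p : X.graph.Walk x y)
    (hx : x ∈ X.outward x₀ k) (hy : y ∈ X.inward x₀ k) : ∃ e ∈ p.edges, e ∈ X.edgesOf k := by
  induction p with
  | nil => exact (hx hy).elim
  | @cons x v y h p ih =>
    by_cases hk : X.dual h = k
    · exact ⟨s(x, v), by simp, (mem_edgesOf h k).2 hk⟩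
    · obtain ⟨e, he, he'⟩ := ih (fun hv => hx ((mem_inward_iff_of_ne h hk).2 hv)) hy
      exact ⟨e, by simp [he], he'⟩

theorem IsRankColouring.isControlled (hX : X.IsCAT0) (hD : X.HasDimension D)
    {c : X.Hyperplane → Fin 2} (hc : X.IsRankColouring x₀ D c) :
    X.IsControlled x₀ (3 ^ (X.flatness x₀ - 1) * D) c := by
  rintro x y p ⟨-, hp⟩ ⟨b, hb⟩
  obtain ⟨-, S', hS', hsub⟩ := exists_finset_crossed hX p hp
  have hfin : {h | x ∈ X.outward x₀ h ∧ y ∈ X.inward x₀ h}.Finite :=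
    (finite_outward hX x₀ x).subset fun h hh => hh.1
  have hmem : ∀ h, h ∈ hfin.toFinset ↔ x ∈ X.outward x₀ h ∧ y ∈ X.inward x₀ h := by simp
  rw [← hS']
  refine (Finset.card_le_card (t := hfin.toFinset) fun h hh => (hmem h).2 (hsub h hh)).trans ?_
  refine HasEscapes.card_le hX hD (v := x) (hc.hasEscapes hX (b := b) ?_ ?_)
    fun h hh => ((hmem h).1 hh).1
  · intro h hh
    obtain ⟨hx, hy⟩ := (hmem h).1 hh
    obtain ⟨e, he, heh⟩ := exists_mem_edges_of_separated p hx hy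
    exact hb e he h heh
  · intro g hg h hh k hgk hkh
    -- Convexity: `x ∈ h⁺ ⊆ k⁺`, and `y ∉ k⁺` because `k⁺ ⊆ g⁺` and `y ∈ g⁻`.
    refine (hmem k).2 ⟨hkh.1 ((hmem h).1 hh).1, ?_⟩
    exact not_not.1 fun hy => hgk.1 hy ((hmem g).1 hg).2

end CubeComplex

theorem mainTheorem3 {V : Type u} (X : CubeComplex V) (hX : X.IsCAT0) (x₀ : V)
    (D : ℕ) (hD : X.HasDimension D) (f : ℕ) (hf : X.flatness x₀ = f) :
    (∃! c : X.Hyperplane → Fin 2, X.IsRankColouring x₀ D c) ∧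
      ∀ c : X.Hyperplane → Fin 2, X.IsRankColouring x₀ D c →
        X.IsControlled x₀ (3 ^ (f - 1) * D) c := by
  subst hf
  exact ⟨CubeComplex.existsUnique_isRankColouring hX x₀ D, fun _ hc => hc.isControlled hX hD⟩
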